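/- Let $X=\{0,1,2\}$ and let $X^{\omega}$ be the space of left-infinite words $\dots x_2x_1x_0$ over $X$, with the product topology; all actions are right actions. Let $a$ and $b$ be the generators of the Fabrykowski–Gupta group: $a$ adds $1$ (mod $3$) to the last letter, and $b=(a,\mathrm{Id},b)$, i.e. $v0\cdot b=(v\cdot a)0$, $v1\cdot b=v1$, $v2\cdot b=(v\cdot b)2$. Put $\xi=2^{\omega}$ and $W_n=X^{\omega}02^n$. All indices $i,j$ run over $\{1,2,3,4\}$ and are read modulo $4$. Let $e_1=(0,1,2,1)$ and $e_2=(1,1,1,0)$. Let $b_1^{(i)}$ and $b_2^{(i)}$ act on $W_n$ as $b^{e_1(i+n)}$ and $b^{e_2(i+n)}$ respectively, for every $n\ge 0$, and trivially outside $\bigcup_n W_n$. Put $H_i=\langle b_1^{(i)},b_2^{(i)}\rangle$ and $G_i=\langle a,H_i\rangle$. For the piece $P_{i,j}=\bigcup_{n\equiv j-i\ (4)}W_n$ let $\pi_j:H_i\to\mathbb Z/3$ be such that $h$ acts on $P_{i,j}$ as $b^{\pi_j(h)}$; connector $(j)$ is the Cayley graph of the image of $\pi_j$, a triangle on which the elements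 of $\ker\pi_j$ are loops. Traverses. For $k\ge 2$ let $\mathcal T_k$ be the tile of level $k$ (the words of length $k$), with boundary points $\eta_k=02^{k-1}$ and $\xi_k=2^k$. A bridge of rank $k$ with connector $(j)$ consists, for some $m\ge k$ with $i+m\equiv j\pmod 4$ and some tail $u$, of the three copies $uy02^{m-k}\mathcal T_k$ ($y\in X$) of $\mathcal T_k$ in an orbital graph of $G_i$; these copies are joined at their points $\xi_k$ by connector $(j)$. A word $w$ in the letters $\langle a\rangle\cup H_i$ performs a traverse of $2^{\omega}\mathcal T_k$, or of a bridge, if its walk stays there, starts and ends at a point $\eta_k$ of a copy of $\mathcal T_k$, touches no such point in between, and visits a point $\xi_k$. The graph of germs of $G_i$ at $\xi$ has as vertices the germs at $\xi$ of the elements of $G_i$; the germ of $g$ lies in the branch of $h\in H_i$ if near $\xi$ the words $x\cdot g$ and $x\cdot h$ agree except possibly in a fixed number of last letters. A word $w$ is a rank $k$ traverse of type $h$ if it performs a traverse of $2^{\omega}\mathcal T_k$ from $2^\omega\eta_k$ whose lift to the graph of germs goes from the branch of $\mathrm{Id}$ to the branch of $h$. It is a rank $k$ traverse of type $c\in\mathbb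 Z/3$ passing through connector $(j)$ if on every bridge of rank $k$ with connector $(j)$, from the point $\eta_k$ of every copy $y$ of $\mathcal T_k$, it performs a traverse that ends in copy $y+c$; for $c=0$ it is said to be of type $\mathrm{Id}$. Then the following hold. 1. $b_1^{(i)}=(a^{e_1(i)},\mathrm{Id},b_1^{(i+1)})$ and $b_2^{(i)}=(a^{e_2(i)},\mathrm{Id},b_2^{(i+1)})$, and $(G_i)$ is a self-similar family: for all $g\in G_i$ and $y\in X$ there are $g'\in G_{i+1}$ and $y'\in X$ with $vy\cdot g=(v\cdot g')y'$ for all $v$. 2. $H_i\cong(\mathbb Z/3)^2$. $H_i$ is a fragmentation of $b$: its elements are trivial on $\mathrm{Fix}(b)$, each $\pi_j$ is well defined, and $\pi_j(b_1^{(i)})=e_1(j)$, $\pi_j(b_2^{(i)})=e_2(j)$. Every non-identity $h\in H_i$ has exactly one $j$ with $\pi_j(h)=0$. The group $H_i$ fixes $\xi$ and is the group of germs of $G_i$ at $\xi$ (every $g\in G_i$ fixing $\xi$ coincides near $\xi$ with exactly one $h\in H_i$), and every germ at $\xi$ of an element of $G_i$ lies in the branch of exactly one $h\in H_i$. 3.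 Let $k\ge 2$, $\mathrm{Id}\ne h\in H_i$, and let $w$ be a rank $k$ traverse of type $h$. Then for every $j$, $w$ is a rank $k$ traverse of type $\pi_j(h)$ passing through connector $(j)$. Whenever $w$ is a rank $k$ traverse of nontrivial type passing through connector $(j)$, there is $j'\ne j$ such that $w$ is a rank $k$ traverse of type $\mathrm{Id}$ passing through connector $(j')$. 4. Let $\eta=(3/4)^{1/3}$. For every $i$, every finite symmetric generating set of $G_i$ and every $\alpha>\frac{\log 3}{\log 3-\log\eta}\approx 0.9197$ (with error less than $5\cdot10^{-5}$), the corresponding growth function satisfies $\gamma_{G_i}(R)\preccurlyeq\exp(R^{\alpha})$: there is $C\ge 1$ with $\gamma_{G_i}(R)\le\exp((CR)^{\alpha})$ for all $R\ge 1$. -/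

import Mathlib

open Filter Topology

noncomputable section

namespace FabrykowskiGupta

/-- The space of left-infinite words over the alphabet `{0, 1, 2}`, with the product topology.
The letter `x 0` is the rightmost letter, the one read first: `x = … x 2, x 1, x 0`.
It is the boundary of the ternary rooted tree. -/
abbrev Pt : Type := ℕ → ZMod 3

/-- The word `v y`: the letter `y` appended on the right of `v`. -/
def snoc (v : Pt) (y : ZMod 3) : Pt
  | 0 => y
  | n + 1 => v n

/-- The singular point `… 2 2 2`. -/
def xi : Pt := fun _ => 2

/-- `W n` is the set of words ending in `0 2 ⋯ 2` with exactly `n` letters `2`. -/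
def W (n : ℕ) : Set Pt := {x | x n = 0 ∧ ∀ k < n, x k = 2}

/-- The generator `a = (0 1 2)`: it adds `1` to the rightmost letter. -/
def a : Equiv.Perm Pt where
  toFun x := snoc (fun n => x (n + 1)) (x 0 + 1)
  invFun x := snoc (fun n => x (n + 1)) (x 0 - 1)
  left_inv x := by
    funext n
    cases n <;> simp [snoc]
  right_inv x := by
    funext n
    cases n <;> simp [snoc]

/-- The map that adds `c n` to the letter with index `n + 1` of the words in `W n`, for every `n`,
and changes nothing else. -/
def twistFun (c : ℕ → ZMod 3) (x : Pt) : Pt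
  | 0 => x 0
  | n + 1 => if x n = 0 ∧ ∀ k < n, x k = 2 then x (n + 1) + c n else x (n + 1)

theorem twistFun_mem_W (c : ℕ → ZMod 3) (x : Pt) (n : ℕ) :
    twistFun c x ∈ W n ↔ x ∈ W n := by
  have key : ∀ n, (∀ k < n, x k = 2) → ∀ k ≤ n, twistFun c x k = x k := by
    intro n hn k hk
    cases k with
    | zero => rfl
    | succ k =>
      have h2 : x k = 2 := hn k (by omega)
      have : ¬ (x k = 0 ∧ ∀ j < k, x j = 2) := by
        rintro ⟨h0, -⟩
        rw [h0] at h2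
        exact absurd h2 (by decide)
      simp only [twistFun, if_neg this]
  have key' : ∀ n, (∀ k < n, twistFun c x k = 2) → ∀ k < n, x k = 2 := by
    intro n
    induction n with
    | zero => intro _ k hk; omega
    | succ n ih =>
      intro h k hk
      have h1 := ih (fun k hk => h k (by omega))
      have h2 := key n h1 k (by omega)
      rw [← h2]
      exact h k hk
  constructor
  · rintro ⟨h0, h2⟩
    have h3 := key' n h2
    exact ⟨by rw [← key n h3 n le_rfl]; exact h0, h3⟩
  · rintro ⟨h0, h2⟩
    exact ⟨by rw [key n h2 n le_rfl]; exact h0,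
      fun k hk => by rw [key n h2 k hk.le]; exact h2 k hk⟩

theorem twistFun_twistFun (c d : ℕ → ZMod 3) (x : Pt) :
    twistFun c (twistFun d x) = twistFun (fun n => d n + c n) x := by
  funext m
  cases m with
  | zero => rfl
  | succ n =>
    have h : (twistFun d x n = 0 ∧ ∀ k < n, twistFun d x k = 2) ↔
        (x n = 0 ∧ ∀ k < n, x k = 2) := twistFun_mem_W d x n
    by_cases hx : x n = 0 ∧ ∀ k < n, x k = 2
    · have hd : twistFun d x (n + 1) = x (n + 1) + d n := if_pos hx
      have h1 : twistFun c (twistFun d x) (n + 1) = twistFun d x (n + 1) + c n :=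
        if_pos (h.2 hx)
      have h2 : twistFun (fun n => d n + c n) x (n + 1) = x (n + 1) + (d n + c n) := if_pos hx
      rw [h1, h2, hd, add_assoc]
    · have hd : twistFun d x (n + 1) = x (n + 1) := if_neg hx
      have h1 : twistFun c (twistFun d x) (n + 1) = twistFun d x (n + 1) :=
        if_neg (fun h' => hx (h.1 h'))
      have h2 : twistFun (fun n => d n + c n) x (n + 1) = x (n + 1) := if_neg hx
      rw [h1, h2, hd]

theorem twistFun_zero (x : Pt) : twistFun (fun _ => 0) x = x := by
  funext m
  cases m <;> simp [twistFun]

/-- `twistFun c` as a permutation. It acts on each `W n` as the power `b ^ c n` of the generator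
`b` below, see `twist_eq_pow`. -/
def twist (c : ℕ → ZMod 3) : Equiv.Perm Pt where
  toFun := twistFun c
  invFun := twistFun (fun n => -c n)
  left_inv x := by
    rw [twistFun_twistFun]
    simpa using twistFun_zero x
  right_inv x := by
    rw [twistFun_twistFun]
    simpa using twistFun_zero x

/-- The generator `b = (a, Id, b)` of the Fabrykowski–Gupta group. -/
def b : Equiv.Perm Pt := twist (fun _ => 1)

theorem b_pow (k : ℕ) (x : Pt) : (b ^ k) x = twistFun (fun _ => (k : ZMod 3)) x := by
  induction k with
  | zero => simpa using (twistFun_zero x).symm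
  | succ k ih =>
    rw [pow_succ', Equiv.Perm.mul_apply, ih]
    change twistFun (fun _ => 1) (twistFun (fun _ => (k : ZMod 3)) x) = _
    rw [twistFun_twistFun]
    push_cast
    rfl

theorem twist_eq_pow (c : ℕ → ZMod 3) (n : ℕ) (x : Pt) (hx : x ∈ W n) :
    twist c x = (b ^ (c n).val) x := by
  rw [b_pow, ZMod.natCast_zmod_val]
  change twistFun c x = _
  funext m
  cases m with
  | zero => rfl
  | succ m =>
    by_cases hm : x m = 0 ∧ ∀ k < m, x k = 2
    · have hmn : m = n := by
        rcases lt_trichotomy m n with h | h | h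
        · have h2 := hx.2 m h
          rw [hm.1] at h2
          exact absurd h2 (by decide)
        · exact h
        · have h2 := hm.2 n h
          rw [hx.1] at h2
          exact absurd h2 (by decide)
      subst hmn
      rfl
    · simp only [twistFun, if_neg hm]

/-- Exponents of the first fragment at the connectors `(1), (2), (3), (4)` : `0, 1, 2, 1`.
The four connectors, and the four groups, are indexed by `ZMod 4`, so that `(4)` is `0`. -/
def e₁ : ZMod 4 → ZMod 3 := ![1, 0, 1, 2]

/-- Exponents of the second fragment at the connectors `(1), (2), (3), (4)` : `1, 1, 1, 0`. -/
def e₂ : ZMod 4 → ZMod 3 := ![0, 1, 1, 1]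

/-- The fragment of `b` that acts on `W n` as the power of `b` with exponent `e₁ (i + n)`. -/
def b₁ (i : ZMod 4) : Equiv.Perm Pt := twist (fun n => e₁ (i + n))

/-- The fragment of `b` that acts on `W n` as the power of `b` with exponent `e₂ (i + n)`. -/
def b₂ (i : ZMod 4) : Equiv.Perm Pt := twist (fun n => e₂ (i + n))

/-- The group `H_i` generated by the two fragments of `b`. -/
def H (i : ZMod 4) : Subgroup (Equiv.Perm Pt) := Subgroup.closure {b₁ i, b₂ i}

/-- The group `G_i` generated by `a` and `H_i`. -/
def G (i : ZMod 4) : Subgroup (Equiv.Perm Pt) :=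
  Subgroup.closure ({a} ∪ (H i : Set (Equiv.Perm Pt)))

/-- In `G_i`, the piece belonging to the connector `(j)` is the union of the sets `W n` with
`i + n ≡ j` modulo `4`. -/
def piece (i j : ZMod 4) : Set Pt := ⋃ (n : ℕ) (_ : i + (n : ZMod 4) = j), W n

/-- `h` acts as `b ^ c` on the piece of the connector `(j)` of `G_i`. For `h ∈ H_i` this says that
the `j`-th coordinate of `h` in `(ℤ/3)⁴` is `c`; the connector `(j)` is the Cayley graph of
the image of `H_i` under this coordinate. -/
def ActsAs (i j : ZMod 4) (h : Equiv.Perm Pt) (c : ZMod 3) : Prop :=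
  ∀ x ∈ piece i j, h x = (b ^ c.val) x

/-- The right action of a word `s₁ s₂ ⋯ s_l`: first `s₁`, then `s₂`, and so on. -/
def act (w : List (Equiv.Perm Pt)) (x : Pt) : Pt := w.foldl (fun y s => s y) x

/-- The word `y` ends in the boundary point `0 2 ⋯ 2` (with `k` letters) of the tile of
level `k`. -/
def EndsInEta (k : ℕ) (y : Pt) : Prop := ∀ n < k, y n = if n + 1 = k then 0 else 2

/-- The word `y` ends in the boundary point `2 ⋯ 2` (with `k` letters) of the tile of level `k`. -/
def EndsInXi (k : ℕ) (y : Pt) : Prop := ∀ n < k, y n = 2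

/-- The tile of level `k` inside the orbital graph of `xi`: words that may differ from `… 2 2 2`
only in the last `k` letters. -/
def tile (k : ℕ) : Set Pt := {y | ∀ n, k ≤ n → y n = 2}

/-- The bridge of rank `k` inside the orbital graph of a word with tail `u`, around the connector
at the words ending in `0 2 ⋯ 2` with `m ≥ k` letters `2`. Its three copies of the tile
of level `k` are given by the letter with index `m + 1`; they are joined to one another at
the words ending in `2 ⋯ 2` (`k` letters). -/
def bridge (k m : ℕ) (u : Pt) : Set Pt :=
  {y | (∀ n, k ≤ n → n < m → y n = 2) ∧ y m = 0 ∧ ∀ n, m + 2 ≤ n → y n = u n}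

/-- The walk of the word `w` from `z` stays in `B`, it starts and ends at the boundary point
`0 2 ⋯ 2` of a copy of the tile of level `k` in `B` and does not touch
such boundary points in between, and it passes through a boundary point `2 ⋯ 2`, where
the copies of the tile are joined. -/
structure IsTraverse (k : ℕ) (B : Set Pt) (w : List (Equiv.Perm Pt)) (z : Pt) : Prop where
  stays : ∀ j ≤ w.length, act (w.take j) z ∈ B
  starts : EndsInEta k z
  ends : EndsInEta k (act w z)
  inside : ∀ j, 0 < j → j < w.length → ¬ EndsInEta k (act (w.take j) z)
  crosses : ∃ j ≤ w.length, EndsInXi k (act (w.take j) z)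

/-- The germ of `f` at `xi` lies in the branch of `h` of the graph of germs: near `xi`, the map `f`
is `h` followed by a change of a fixed number of letters on the right. -/
def InBranch (f : Pt → Pt) (h : Equiv.Perm Pt) : Prop :=
  ∃ k : ℕ, ∀ᶠ x in 𝓝 xi, ∀ n, k ≤ n → f x n = h x n

/-- The word `w`, in the letters `⟨a⟩ ∪ H_i`, is a rank `k` traverse of type `h`: it performs
a traverse of the tile of level `k` in the orbital graph of `xi`, and its lift to the graph of
germs of `G_i` at `xi`, whose vertices are the germs of elements of `G_i` at `xi`, goes from
the branch of the identity (from the germ of `t`) to the branch of `h`. -/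
def IsTraverseOfType (i : ZMod 4) (k : ℕ) (w : List (Equiv.Perm Pt)) (h : Equiv.Perm Pt) : Prop :=
  (∀ s ∈ w, s ∈ Subgroup.zpowers a ∨ s ∈ H i) ∧
  ∃ t ∈ G i, InBranch t 1 ∧ IsTraverse k (tile k) w (t xi) ∧ InBranch (fun x => act w (t x)) h

/-- The word `w` is a rank `k` traverse passing through the connector `(j)` of `G_i`, of type `c`:
on every bridge of rank `k` with connector `(j)`, from every copy of the tile, it performs
a traverse, which leads from the copy with letter `y` to the copy with letter `y + c`.
For `c = 0` this is a traverse of type `Id`: it comes back to the copy where it started. -/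
def PassesConnector (i : ZMod 4) (k : ℕ) (j : ZMod 4) (w : List (Equiv.Perm Pt)) (c : ZMod 3) :
    Prop :=
  ∀ m : ℕ, k ≤ m → i + (m : ZMod 4) = j → ∀ u z : Pt, z ∈ bridge k m u → EndsInEta k z →
    IsTraverse k (bridge k m u) w z ∧ act w z = Function.update z (m + 1) (z (m + 1) + c)

/-- The growth function of a group with respect to `S`: the number of elements that are products
of at most `R` elements of `S`. -/
def growth {Γ : Type*} [Group Γ] (S : Set Γ) (R : ℝ) : ℕ :=
  Set.ncard {g : Γ | ∃ l : List Γ, (∀ s ∈ l, s ∈ S) ∧ l.prod = g ∧ (l.length : ℝ) ≤ R}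

/-- Domination of growth functions. -/
def Dominated (f₁ f₂ : ℝ → ℝ) : Prop :=
  ∃ C : ℝ, 1 ≤ C ∧ ∀ R : ℝ, 1 ≤ R → f₁ R ≤ f₂ (C * R)

end FabrykowskiGupta

end

/-!
The coordinates at the four connectors embed `H i` into `(ℤ/3)⁴` as a linear code of dimension two
in which every nonzero word has exactly one zero. The walk of a traverse of the tile at `xi` does
not depend on the tail of the word: on the words that end in `2 ⋯ 2` with `k` letters, an initial
segment of the word acts on the last `k` letters in a fixed way and on the others as some
`h ∈ H i`. Applied to the words in `W m`, this describes the walk on a bridge with connector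
`(i + m)`, which moves from copy to copy by the coordinate of `h`. As `h` has a zero coordinate,
the traverse returns to its copy at some connector.

The growth estimate follows the same principle. Give `a ^ e` weight `4`, and give a fragment one of
the weights `3, 4, 5, 6` according to the position of its zero relative to `i`. A fragment `h` whose
coordinate at `i` vanishes passes only one nontrivial section on to the next level, and otherwise
its zero moves one step closer; the weights are such that the sections of `a ^ e * h` have
at most `9 / 10` of its weight. An element is determined by its action on the last letter and
its three sections, so the balls satisfy a recursion with three branches and contraction `9 / 10`.
By concavity of `x ↦ x ^ β` it forces growth at most `exp (R ^ β)` as soon as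
`3 ^ (1 - β) * (9 / 10) ^ β < 1`. Since `9 / 10 < (3 / 4) ^ (1 / 3)`, this covers the exponents of
the theorem.
-/

namespace FabrykowskiGupta

/-! ### Words and the generator `a` -/

theorem snoc_tail (x : Pt) : snoc (fun n => x (n + 1)) (x 0) = x := by
  funext n
  cases n <;> rfl

theorem perm_ext_snoc {g h : Equiv.Perm Pt} (H : ∀ v y, g (snoc v y) = h (snoc v y)) : g = h :=
  Equiv.ext fun x => by rw [← snoc_tail x, H]

theorem a_snoc (v : Pt) (y : ZMod 3) : a (snoc v y) = snoc v (y + 1) := rfl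

theorem a_pow_snoc (n : ℕ) (v : Pt) (y : ZMod 3) : (a ^ n) (snoc v y) = snoc v (y + n) := by
  induction n generalizing y with
  | zero => simp
  | succ n ih => rw [pow_succ, Equiv.Perm.mul_apply, a_snoc, ih, Nat.cast_succ, add_assoc,
      add_comm (1 : ZMod 3)]

/-- The power of `a` that adds `e` to the rightmost letter. -/
def rot (e : ZMod 3) : Equiv.Perm Pt := a ^ e.val

theorem rot_snoc (e : ZMod 3) (v : Pt) (y : ZMod 3) : rot e (snoc v y) = snoc v (y + e) := by
  rw [rot, a_pow_snoc, ZMod.natCast_zmod_val]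

theorem rot_apply_zero (e : ZMod 3) (x : Pt) : rot e x 0 = x 0 + e := by
  rw [← snoc_tail x, rot_snoc]
  rfl

theorem rot_apply_succ (e : ZMod 3) (x : Pt) (n : ℕ) : rot e x (n + 1) = x (n + 1) := by
  rw [← snoc_tail x, rot_snoc]
  rfl

theorem rot_mul_rot (d e : ZMod 3) : rot d * rot e = rot (d + e) :=
  perm_ext_snoc fun v y => by
    simp only [Equiv.Perm.mul_apply, rot_snoc, add_assoc, add_comm e d]

theorem rot_zero : rot 0 = 1 := pow_zero a

theorem rot_one : rot 1 = a := pow_one a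

theorem exists_eq_rot_of_mem_zpowers {s : Equiv.Perm Pt} (hs : s ∈ Subgroup.zpowers a) :
    ∃ e, s = rot e := by
  obtain ⟨k, rfl⟩ := hs
  have a_pow_three : a ^ 3 = 1 := perm_ext_snoc fun v y => by
    rw [a_pow_snoc, CharP.cast_eq_zero (ZMod 3) 3, add_zero, Equiv.Perm.one_apply]
  refine ⟨(k : ZMod 3), ?_⟩
  rw [rot, ← zpow_natCast, ZMod.val_intCast]
  exact zpow_eq_zpow_emod' k a_pow_three

/-! ### Twists -/

theorem eq_of_mem_W {m n : ℕ} {x : Pt} (hm : x ∈ W m) (hn : x ∈ W n) : m = n := by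
  have le_of_mem : ∀ {k l : ℕ}, x ∈ W k → x ∈ W l → l ≤ k := fun hk hl => by
    by_contra! h
    have h02 : (0 : ZMod 3) = 2 := hk.1.symm.trans (hl.2 _ h)
    exact absurd h02 (by decide)
  exact le_antisymm (le_of_mem hn hm) (le_of_mem hm hn)

theorem mem_W_congr {x y : Pt} {n : ℕ} (h : ∀ m ≤ n, x m = y m) : x ∈ W n ↔ y ∈ W n :=
  and_congr (by rw [h n le_rfl]) (forall₂_congr fun k hk => by rw [h k hk.le])

theorem twist_apply_succ_of_mem {c : ℕ → ZMod 3} {x : Pt} {n : ℕ} (h : x ∈ W n) :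
    twist c x (n + 1) = x (n + 1) + c n := if_pos h

theorem twist_apply_succ_of_notMem {c : ℕ → ZMod 3} {x : Pt} {n : ℕ} (h : x ∉ W n) :
    twist c x (n + 1) = x (n + 1) := if_neg h

theorem twist_apply_of_mem_W {c : ℕ → ZMod 3} {x : Pt} {n : ℕ} (h : x ∈ W n) :
    twist c x = Function.update x (n + 1) (x (n + 1) + c n) := by
  funext m
  rcases eq_or_ne m (n + 1) with rfl | hm
  · rw [twist_apply_succ_of_mem h, Function.update_self]
  rw [Function.update_of_ne hm]
  cases m with
  | zero => rfl
  | succ m => exact twist_apply_succ_of_notMem fun h' => hm (by rw [eq_of_mem_W h' h])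

theorem twist_apply_of_notMem {c : ℕ → ZMod 3} {x : Pt} (h : ∀ n, x ∉ W n) : twist c x = x := by
  funext m
  cases m with
  | zero => rfl
  | succ m => exact twist_apply_succ_of_notMem (h m)

theorem twist_congr {c d : ℕ → ZMod 3} {x : Pt} (h : ∀ n, x ∈ W n → c n = d n) :
    twist c x = twist d x := by
  by_cases hx : ∃ n, x ∈ W n
  · obtain ⟨n, hn⟩ := hx
    rw [twist_apply_of_mem_W hn, twist_apply_of_mem_W hn, h n hn]
  · push Not at hx
    rw [twist_apply_of_notMem hx, twist_apply_of_notMem hx]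

theorem twist_mul_twist (c d : ℕ → ZMod 3) : twist c * twist d = twist (c + d) :=
  Equiv.ext fun x => (twistFun_twistFun c d x).trans <| by
    rw [add_comm c d]
    rfl

theorem twist_zero : twist 0 = 1 := Equiv.ext twistFun_zero

theorem twist_const_eq_b_pow (c : ZMod 3) : twist (fun _ => c) = b ^ c.val :=
  Equiv.ext fun x => by
    rw [b_pow, ZMod.natCast_zmod_val]
    rfl

theorem EndsInXi.notMem_W {k n : ℕ} {x : Pt} (hx : EndsInXi k x) (hn : n < k) : x ∉ W n :=
  fun h => absurd (h.1.symm.trans (hx n hn)) (by decide)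

theorem xi_notMem_W (n : ℕ) : xi ∉ W n :=
  EndsInXi.notMem_W (fun _ _ => rfl) n.lt_succ_self

theorem twist_xi (c : ℕ → ZMod 3) : twist c xi = xi := twist_apply_of_notMem xi_notMem_W

theorem EndsInXi.twist_apply {k n : ℕ} {x : Pt} (hx : EndsInXi k x) (hn : n ≤ k)
    (c : ℕ → ZMod 3) : twist c x n = x n := by
  cases n with
  | zero => rfl
  | succ n => exact twist_apply_succ_of_notMem (hx.notMem_W hn)

theorem snoc_mem_W_zero_iff {v : Pt} {y : ZMod 3} : snoc v y ∈ W 0 ↔ y = 0 :=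
  and_iff_left fun _ h => absurd h (Nat.not_lt_zero _)

theorem snoc_mem_W_succ_iff {v : Pt} {y : ZMod 3} {n : ℕ} :
    snoc v y ∈ W (n + 1) ↔ v ∈ W n ∧ y = 2 := by
  simp only [W, Set.mem_ofPred_eq, Nat.forall_lt_succ_left', snoc, and_assoc,
    and_comm (a := y = 2)]

theorem twist_snoc_zero (c : ℕ → ZMod 3) (v : Pt) :
    twist c (snoc v 0) = snoc (rot (c 0) v) 0 := by
  funext n
  rw [twist_apply_of_mem_W (snoc_mem_W_zero_iff.2 rfl)]
  match n with
  | 0 => rfl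
  | 1 => exact (rot_apply_zero (c 0) v).symm
  | n + 2 => exact (rot_apply_succ (c 0) v n).symm

theorem twist_snoc_one (c : ℕ → ZMod 3) (v : Pt) : twist c (snoc v 1) = snoc v 1 := by
  refine twist_apply_of_notMem fun n => ?_
  cases n with
  | zero => rw [snoc_mem_W_zero_iff]; decide
  | succ n => exact fun h => absurd (snoc_mem_W_succ_iff.1 h).2 (by decide)

theorem twist_snoc_two (c : ℕ → ZMod 3) (v : Pt) :
    twist c (snoc v 2) = snoc (twist (fun n => c (n + 1)) v) 2 := by
  funext m
  match m with
  | 0 => rfl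
  | 1 => exact twist_apply_succ_of_notMem fun h => absurd (snoc_mem_W_zero_iff.1 h) (by decide)
  | m + 2 =>
    by_cases h : v ∈ W m
    · exact (twist_apply_succ_of_mem (snoc_mem_W_succ_iff.2 ⟨h, rfl⟩)).trans
        (twist_apply_succ_of_mem (c := fun n => c (n + 1)) h).symm
    · exact (twist_apply_succ_of_notMem fun h' => h (snoc_mem_W_succ_iff.1 h').1).trans
        (twist_apply_succ_of_notMem h).symm

theorem b_snoc_zero (v : Pt) : b (snoc v 0) = snoc (a v) 0 := by
  rw [b, twist_snoc_zero, rot_one]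

/-! ### The fragments -/

/-- The coordinate at the connector `(j)` of the fragment `b₁ i ^ p * b₂ i ^ q`, as a function of
the pair of exponents `z = (p, q)`. -/
def coord (z : ZMod 3 × ZMod 3) (j : ZMod 4) : ZMod 3 := z.1 * e₁ j + z.2 * e₂ j

theorem coord_add (z z' : ZMod 3 × ZMod 3) (j : ZMod 4) :
    coord (z + z') j = coord z j + coord z' j := by
  simp only [coord, Prod.fst_add, Prod.snd_add]
  ring

theorem coord_zero (j : ZMod 4) : coord 0 j = 0 := by
  simp only [coord, Prod.fst_zero, Prod.snd_zero, zero_mul, add_zero]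

theorem coord_one_zero (j : ZMod 4) : coord (1, 0) j = e₁ j := by
  simp only [coord, one_mul, zero_mul, add_zero]

theorem coord_zero_one (j : ZMod 4) : coord (0, 1) j = e₂ j := by
  simp only [coord, one_mul, zero_mul, zero_add]

theorem coord_injective : Function.Injective coord := fun z z' h =>
  Prod.ext (by simpa [coord, e₁, e₂] using congrFun h 0)
    (by simpa [coord, e₁, e₂] using congrFun h 1)

theorem existsUnique_coord_eq_zero {z : ZMod 3 × ZMod 3} (hz : z ≠ 0) :
    ∃! j, coord z j = 0 := by
  revert z
  unfold ExistsUnique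
  decide

/-- The element `b₁ i ^ p * b₂ i ^ q` of `H i`, where `z = (p, q)`. -/
def frag (i : ZMod 4) (z : ZMod 3 × ZMod 3) : Equiv.Perm Pt := twist fun n => coord z (i + n)

theorem b₁_eq_frag (i : ZMod 4) : b₁ i = frag i (1, 0) := by
  simp only [b₁, frag, coord_one_zero]

theorem b₂_eq_frag (i : ZMod 4) : b₂ i = frag i (0, 1) := by
  simp only [b₂, frag, coord_zero_one]

theorem frag_mul_frag (i : ZMod 4) (z z' : ZMod 3 × ZMod 3) :
    frag i z * frag i z' = frag i (z + z') :=
  (twist_mul_twist _ _).trans <| congrArg twist <| funext fun n => (coord_add z z' (i + n)).symm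

theorem frag_zero (i : ZMod 4) : frag i 0 = 1 :=
  (congrArg twist (funext fun n => coord_zero (i + n))).trans twist_zero

theorem frag_snoc_zero (i : ZMod 4) (z : ZMod 3 × ZMod 3) (v : Pt) :
    frag i z (snoc v 0) = snoc (rot (coord z i) v) 0 := by
  rw [frag, twist_snoc_zero, Nat.cast_zero, add_zero]

theorem frag_snoc_one (i : ZMod 4) (z : ZMod 3 × ZMod 3) (v : Pt) :
    frag i z (snoc v 1) = snoc v 1 := twist_snoc_one _ v

theorem frag_snoc_two (i : ZMod 4) (z : ZMod 3 × ZMod 3) (v : Pt) :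
    frag i z (snoc v 2) = snoc (frag (i + 1) z v) 2 := by
  rw [frag, twist_snoc_two, frag]
  simp only [Nat.cast_succ, add_assoc, add_comm (1 : ZMod 4)]

theorem b₁_snoc_zero (i : ZMod 4) (v : Pt) : b₁ i (snoc v 0) = snoc ((a ^ (e₁ i).val) v) 0 := by
  rw [b₁_eq_frag, frag_snoc_zero, coord_one_zero, rot]

theorem b₁_snoc_two (i : ZMod 4) (v : Pt) : b₁ i (snoc v 2) = snoc (b₁ (i + 1) v) 2 := by
  rw [b₁_eq_frag, frag_snoc_two, b₁_eq_frag]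

theorem b₂_snoc_zero (i : ZMod 4) (v : Pt) : b₂ i (snoc v 0) = snoc ((a ^ (e₂ i).val) v) 0 := by
  rw [b₂_eq_frag, frag_snoc_zero, coord_zero_one, rot]

theorem b₂_snoc_two (i : ZMod 4) (v : Pt) : b₂ i (snoc v 2) = snoc (b₂ (i + 1) v) 2 := by
  rw [b₂_eq_frag, frag_snoc_two, b₂_eq_frag]

theorem exists_index (k : ℕ) (i j : ZMod 4) : ∃ n, k ≤ n ∧ i + (n : ZMod 4) = j :=
  ⟨4 * k + (j - i).val, by omega, by
    rw [Nat.cast_add, Nat.cast_mul, ZMod.natCast_zmod_val, show ((4 : ℕ) : ZMod 4) = 0 from rfl]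
    ring⟩

theorem W_nonempty (n : ℕ) : (W n).Nonempty :=
  ⟨Function.update xi n 0, Function.update_self .., fun _ hk => Function.update_of_ne hk.ne ..⟩

theorem actsAs_frag_iff {i j : ZMod 4} {z : ZMod 3 × ZMod 3} {c : ZMod 3} :
    ActsAs i j (frag i z) c ↔ coord z j = c := by
  constructor
  · intro h
    obtain ⟨n, -, hn⟩ := exists_index 0 i j
    obtain ⟨x, hx⟩ := W_nonempty n
    have hxc := congrFun (h x (Set.mem_iUnion₂.2 ⟨n, hn, hx⟩)) (n + 1)
    rwa [← twist_const_eq_b_pow, frag, twist_apply_succ_of_mem hx, twist_apply_succ_of_mem hx,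
      add_right_inj, hn] at hxc
  · rintro rfl x hx
    obtain ⟨n, hn, hxn⟩ := Set.mem_iUnion₂.1 hx
    rw [← twist_const_eq_b_pow]
    exact twist_congr fun m hm => by rw [eq_of_mem_W hm hxn, hn]

theorem frag_injective (i : ZMod 4) : Function.Injective (frag i) := fun _ _ h =>
  coord_injective <| funext fun _ => (actsAs_frag_iff (i := i)).1 (h ▸ actsAs_frag_iff.2 rfl)

/-- The fragments of `b` with respect to the index `i`, as a representation of `(ℤ/3)²`. -/
def fragHom (i : ZMod 4) : Multiplicative (ZMod 3 × ZMod 3) →* Equiv.Perm Pt where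
  toFun z := frag i z.toAdd
  map_one' := frag_zero i
  map_mul' z z' := (frag_mul_frag i z.toAdd z'.toAdd).symm

theorem frag_pow (i : ZMod 4) (z : ZMod 3 × ZMod 3) (n : ℕ) : frag i z ^ n = frag i (n • z) := by
  induction n with
  | zero => rw [pow_zero, zero_smul, frag_zero]
  | succ n ih => rw [pow_succ, ih, frag_mul_frag, succ_nsmul]

theorem frag_mem_H (i : ZMod 4) (z : ZMod 3 × ZMod 3) : frag i z ∈ H i := by
  have hz : z = z.1.val • (1, 0) + z.2.val • (0, 1) := by
    simp only [Prod.smul_mk, nsmul_eq_mul, ZMod.natCast_zmod_val, Prod.mk_add_mk, mul_one, mul_zero,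
      add_zero, zero_add]
  have hfrag : frag i z = b₁ i ^ z.1.val * b₂ i ^ z.2.val := by
    rw [b₁_eq_frag, b₂_eq_frag, frag_pow, frag_pow, frag_mul_frag, ← hz]
  rw [hfrag]
  exact mul_mem (pow_mem (Subgroup.subset_closure (by simp)) _)
    (pow_mem (Subgroup.subset_closure (by simp)) _)

theorem H_eq_range (i : ZMod 4) : H i = (fragHom i).range := by
  refine le_antisymm ((Subgroup.closure_le _).2 ?_) ?_
  · rintro _ (rfl | rfl)
    · exact ⟨.ofAdd (1, 0), (b₁_eq_frag i).symm⟩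
    · exact ⟨.ofAdd (0, 1), (b₂_eq_frag i).symm⟩
  · rintro _ ⟨z, rfl⟩
    exact frag_mem_H i z.toAdd

theorem exists_eq_frag_of_mem_H {i : ZMod 4} {h : Equiv.Perm Pt} (hh : h ∈ H i) :
    ∃ z, h = frag i z := by
  rw [H_eq_range] at hh
  obtain ⟨z, rfl⟩ := hh
  exact ⟨z.toAdd, rfl⟩

theorem nonempty_H_mulEquiv (i : ZMod 4) : Nonempty (H i ≃* Multiplicative (ZMod 3 × ZMod 3)) :=
  ⟨(MulEquiv.subgroupCongr (H_eq_range i)).trans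
    (MonoidHom.ofInjective (f := fragHom i) (frag_injective i)).symm⟩

theorem apply_eq_of_b_apply_eq {i : ZMod 4} {h : Equiv.Perm Pt} {x : Pt} (hh : h ∈ H i)
    (hx : b x = x) : h x = x := by
  obtain ⟨z, rfl⟩ := exists_eq_frag_of_mem_H hh
  refine twist_apply_of_notMem fun n hn => ?_
  have hb : x (n + 1) + 1 = x (n + 1) := by
    rw [← twist_apply_succ_of_mem (c := fun _ => 1) hn]
    exact congrFun hx (n + 1)
  exact one_ne_zero (add_eq_left.1 hb)

theorem apply_xi_of_mem_H {i : ZMod 4} {h : Equiv.Perm Pt} (hh : h ∈ H i) : h xi = xi := by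
  obtain ⟨z, rfl⟩ := exists_eq_frag_of_mem_H hh
  exact twist_xi _

theorem actsAs_b₁ (i j : ZMod 4) : ActsAs i j (b₁ i) (e₁ j) := by
  rw [b₁_eq_frag, actsAs_frag_iff, coord_one_zero]

theorem actsAs_b₂ (i j : ZMod 4) : ActsAs i j (b₂ i) (e₂ j) := by
  rw [b₂_eq_frag, actsAs_frag_iff, coord_zero_one]

theorem existsUnique_actsAs {i : ZMod 4} {h : Equiv.Perm Pt} (hh : h ∈ H i) (j : ZMod 4) :
    ∃! c, ActsAs i j h c := by
  obtain ⟨z, rfl⟩ := exists_eq_frag_of_mem_H hh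
  simp only [actsAs_frag_iff, existsUnique_eq']

theorem existsUnique_actsAs_zero {i : ZMod 4} {h : Equiv.Perm Pt} (hh : h ∈ H i) (h1 : h ≠ 1) :
    ∃! j, ActsAs i j h 0 := by
  obtain ⟨z, rfl⟩ := exists_eq_frag_of_mem_H hh
  simp only [actsAs_frag_iff]
  exact existsUnique_coord_eq_zero fun hz => h1 (by rw [hz, frag_zero])

/-! ### The groups `G i` -/

theorem rot_mem_G (i : ZMod 4) (e : ZMod 3) : rot e ∈ G i :=
  (G i).pow_mem (Subgroup.subset_closure (Or.inl rfl)) _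

theorem frag_mem_G (i : ZMod 4) (z : ZMod 3 × ZMod 3) : frag i z ∈ G i :=
  Subgroup.subset_closure (Or.inr (frag_mem_H i z))

@[elab_as_elim]
theorem G_induction {i : ZMod 4} {p : ∀ g : Equiv.Perm Pt, g ∈ G i → Prop} (one : p 1 (one_mem _))
    (rot_mul : ∀ e g hg, p g hg → p (rot e * g) (mul_mem (rot_mem_G i e) hg))
    (frag_mul : ∀ z g hg, p g hg → p (frag i z * g) (mul_mem (frag_mem_G i z) hg))
    {g : Equiv.Perm Pt} (hg : g ∈ G i) : p g hg := by
  induction hg using Subgroup.closure_induction_left with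
  | one => exact one
  | mul_left s hs g hg ih =>
    rcases hs with rfl | hs
    · simpa only [rot_one] using rot_mul 1 g hg ih
    · obtain ⟨z, rfl⟩ := exists_eq_frag_of_mem_H hs
      exact frag_mul z g hg ih
  | inv_mul_cancel s hs g hg ih =>
    rcases hs with rfl | hs
    · have ha : a⁻¹ = rot (-1) := by
        rw [inv_eq_iff_mul_eq_one, ← rot_one, rot_mul_rot, add_neg_cancel, rot_zero]
      simpa only [ha] using rot_mul (-1) g hg ih
    · obtain ⟨z, hz⟩ := exists_eq_frag_of_mem_H (inv_mem hs)
      simpa only [hz] using frag_mul z g hg ih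

theorem exists_section {i : ZMod 4} {g : Equiv.Perm Pt} (hg : g ∈ G i) (y : ZMod 3) :
    ∃ y', ∃ g' ∈ G (i + 1), ∀ v, g (snoc v y) = snoc (g' v) y' := by
  induction hg using G_induction with
  | one => exact ⟨y, 1, one_mem _, fun _ => rfl⟩
  | rot_mul e g _ ih =>
    obtain ⟨y', g', hg', h⟩ := ih
    exact ⟨y' + e, g', hg', fun v => by rw [Equiv.Perm.mul_apply, h, rot_snoc]⟩
  | frag_mul z g _ ih =>
    obtain ⟨y', g', hg', h⟩ := ih
    have frag_section : ∃ s ∈ G (i + 1), ∀ v, frag i z (snoc v y') = snoc (s v) y' := by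
      fin_cases y'
      · exact ⟨_, rot_mem_G _ _, frag_snoc_zero i z⟩
      · exact ⟨1, one_mem _, frag_snoc_one i z⟩
      · exact ⟨_, frag_mem_G _ _, frag_snoc_two i z⟩
    obtain ⟨s, hs, hsv⟩ := frag_section
    exact ⟨y', s * g', mul_mem hs hg', fun v => by
      rw [Equiv.Perm.mul_apply, h, hsv, Equiv.Perm.mul_apply]⟩

/-! ### Germs at `xi` -/

theorem eventually_nhds_xi_iff {P : Pt → Prop} :
    (∀ᶠ x in 𝓝 xi, P x) ↔ ∃ N, ∀ x, EndsInXi N x → P x := by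
  constructor
  · intro h
    rw [nhds_pi, Filter.eventually_iff, Filter.mem_pi] at h
    obtain ⟨I, hI, t, ht, hsub⟩ := h
    obtain ⟨N, hN⟩ := hI.bddAbove
    refine ⟨N + 1, fun x hx => hsub fun n hn => ?_⟩
    rw [hx n (Nat.lt_succ_of_le (hN hn))]
    exact mem_of_mem_nhds (ht n)
  · rintro ⟨N, h⟩
    have hN : ∀ᶠ x in 𝓝 xi, ∀ n ∈ Finset.range N, x n = 2 := by
      refine (Filter.eventually_all_finset _).2 fun n _ => ?_
      have hn : Tendsto (fun x : Pt => x n) (𝓝 xi) (𝓝 2) := (continuous_apply n).tendsto xi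
      rwa [nhds_discrete (ZMod 3), tendsto_pure] at hn
    filter_upwards [hN] with x hx
    exact h x fun n hn => hx n (Finset.mem_range.2 hn)

/-- On the words ending in `K` letters `2`, the map `f` rewrites the last `K` letters in a fixed
way and acts as `h` on the others. This is a quantitative form of `InBranch f h` which also keeps
track of the value of `f` at `xi`. -/
def InBranchAtLevel (K : ℕ) (f : Pt → Pt) (h : Equiv.Perm Pt) : Prop :=
  ∀ x, EndsInXi K x → (∀ n < K, f x n = f xi n) ∧ ∀ n, K ≤ n → f x n = h x n

theorem endsInXi_xi (K : ℕ) : EndsInXi K xi := fun _ _ => rfl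

theorem EndsInXi.mono {K K' : ℕ} {x : Pt} (hx : EndsInXi K' x) (hK : K ≤ K') : EndsInXi K x :=
  fun n hn => hx n (hn.trans_le hK)

theorem EndsInXi.congr {k : ℕ} {x y : Pt} (hx : EndsInXi k x) (h : ∀ n < k, x n = y n) :
    EndsInXi k y := fun n hn => (h n hn).symm.trans (hx n hn)

theorem EndsInEta.congr {k : ℕ} {x y : Pt} (hx : EndsInEta k x) (h : ∀ n < k, x n = y n) :
    EndsInEta k y := fun n hn => (h n hn).symm.trans (hx n hn)

theorem endsInEta_succ_iff {k : ℕ} {x : Pt} : EndsInEta (k + 1) x ↔ x ∈ W k := by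
  constructor
  · exact fun h => ⟨(h k k.lt_succ_self).trans (if_pos rfl),
      fun n hn => (h n (by omega)).trans (if_neg (by omega))⟩
  · intro h n hn
    split_ifs with hnk
    · rw [Nat.succ_injective hnk, h.1]
    · exact h.2 n (by omega)

theorem twist_apply_congr {c : ℕ → ZMod 3} {x y : Pt} {K n : ℕ} (h : ∀ m < K, x m = y m)
    (hn : n < K) : twist c x n = twist c y n := by
  cases n with
  | zero => exact h 0 hn
  | succ n =>
    have hW : x ∈ W n ↔ y ∈ W n := mem_W_congr fun m hm => h m (by omega)
    by_cases hx : x ∈ W n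
    · rw [twist_apply_succ_of_mem hx, twist_apply_succ_of_mem (hW.1 hx), h _ hn]
    · rw [twist_apply_succ_of_notMem hx, twist_apply_succ_of_notMem (hW.not.1 hx), h _ hn]

theorem twist_apply_of_not_endsIn {c : ℕ → ZMod 3} {x : Pt} {K n : ℕ} (hxi : ¬EndsInXi K x)
    (heta : ¬EndsInEta K x) (hn : K ≤ n) : twist c x n = x n := by
  cases n with
  | zero => rfl
  | succ n =>
    refine twist_apply_succ_of_notMem fun hx => ?_
    rcases hn.lt_or_eq with hn | rfl
    · exact hxi (EndsInXi.mono hx.2 (Nat.lt_succ_iff.1 hn))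
    · exact heta (endsInEta_succ_iff.2 hx)

theorem inBranchAtLevel_twist (K : ℕ) (c : ℕ → ZMod 3) :
    InBranchAtLevel K (twist c) (twist c) := fun x hx =>
  ⟨fun n hn => by rw [hx.twist_apply hn.le, hx n hn, twist_xi, xi], fun _ _ => rfl⟩

namespace InBranchAtLevel

variable {K : ℕ} {f : Pt → Pt} {h : Equiv.Perm Pt} {c : ℕ → ZMod 3}

theorem inBranch (hf : InBranchAtLevel K f h) : InBranch f h :=
  ⟨K, eventually_nhds_xi_iff.2 ⟨K, fun x hx => (hf x hx).2⟩⟩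

theorem congr {f' : Pt → Pt} (hf : InBranchAtLevel K f h)
    (hff' : ∀ x, EndsInXi K x → f' x = f x) : InBranchAtLevel K f' h := fun x hx => by
  rw [hff' x hx, hff' xi (endsInXi_xi K)]
  exact hf x hx

theorem mono {K' : ℕ} (hf : InBranchAtLevel K f (twist c)) (hK : K ≤ K') :
    InBranchAtLevel K' f (twist c) := by
  have apply_eq_two : ∀ {x n}, EndsInXi K' x → K ≤ n → n < K' → f x n = 2 := fun hx hKn hn => by
    rw [(hf _ (hx.mono hK)).2 _ hKn, hx.twist_apply hn.le, hx _ hn]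
  refine fun x hx => ⟨fun n hn => ?_, fun n hn => (hf x (hx.mono hK)).2 n (hK.trans hn)⟩
  rcases lt_or_ge n K with hnK | hnK
  · exact (hf x (hx.mono hK)).1 n hnK
  · rw [apply_eq_two hx hnK hn, apply_eq_two (endsInXi_xi K') hnK hn]

theorem rot_comp (hf : InBranchAtLevel K f h) (hK : 1 ≤ K) (e : ZMod 3) :
    InBranchAtLevel K (rot e ∘ f) h := by
  intro x hx
  refine ⟨fun n hn => ?_, fun n hn => ?_⟩
  · cases n with
    | zero => simp only [Function.comp_apply, rot_apply_zero, (hf x hx).1 0 hn]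
    | succ n => simp only [Function.comp_apply, rot_apply_succ, (hf x hx).1 (n + 1) hn]
  · obtain ⟨n, rfl⟩ := Nat.exists_eq_add_of_le' (hK.trans hn)
    rw [Function.comp_apply, rot_apply_succ, (hf x hx).2 (n + 1) hn]

theorem eq_twist_of_endsInXi (hf : InBranchAtLevel K f (twist c)) (hxi : EndsInXi K (f xi)) {x : Pt}
    (hx : EndsInXi K x) : f x = twist c x := by
  funext n
  rcases lt_or_ge n K with hn | hn
  · rw [(hf x hx).1 n hn, hxi n hn, hx.twist_apply hn.le, hx n hn]
  · exact (hf x hx).2 n hn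

theorem twist_comp_of_endsInXi (hf : InBranchAtLevel K f (twist c)) (hxi : EndsInXi K (f xi))
    (d : ℕ → ZMod 3) : InBranchAtLevel K (twist d ∘ f) (twist (d + c)) :=
  (inBranchAtLevel_twist K (d + c)).congr fun x hx => by
    rw [Function.comp_apply, hf.eq_twist_of_endsInXi hxi hx, ← twist_mul_twist,
      Equiv.Perm.mul_apply]

theorem twist_comp_of_not_endsIn (hf : InBranchAtLevel K f h) (hxi : ¬EndsInXi K (f xi))
    (heta : ¬EndsInEta K (f xi)) (d : ℕ → ZMod 3) : InBranchAtLevel K (twist d ∘ f) h :=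
  fun x hx => ⟨fun _ hn => twist_apply_congr (hf x hx).1 hn, fun n hn => by
    rw [Function.comp_apply, twist_apply_of_not_endsIn (mt (·.congr (hf x hx).1) hxi)
      (mt (·.congr (hf x hx).1) heta) hn, (hf x hx).2 n hn]⟩

end InBranchAtLevel

theorem exists_inBranchAtLevel {i : ZMod 4} {g : Equiv.Perm Pt} (hg : g ∈ G i) :
    ∃ K z, 1 ≤ K ∧ InBranchAtLevel K g (frag i z) := by
  induction hg using G_induction with
  | one => exact ⟨1, 0, le_rfl, frag_zero i ▸ inBranchAtLevel_twist 1 _⟩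
  | rot_mul e g _ ih =>
    obtain ⟨K, z, hK, hf⟩ := ih
    exact ⟨K, z, hK, hf.rot_comp hK e⟩
  | frag_mul d g _ ih =>
    obtain ⟨K, z, hK, hf⟩ := ih
    by_cases hxi : ∀ n, g xi n = 2
    · refine ⟨K, d + z, hK, ?_⟩
      rw [← frag_mul_frag, frag, frag, twist_mul_twist]
      exact hf.twist_comp_of_endsInXi (fun n _ => hxi n) _
    · obtain ⟨n, hn⟩ := not_forall.1 hxi
      refine ⟨max K (n + 2), z, by omega, (hf.mono (le_max_left _ _)).twist_comp_of_not_endsIn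
        (fun h => hn (h n (by omega))) (fun h => hn ?_) _⟩
      exact (h n (by omega)).trans (if_neg (by omega))

theorem eq_of_eventually_frag_apply_eq {i : ZMod 4} {z z' : ZMod 3 × ZMod 3} {k : ℕ}
    (h : ∀ᶠ x in 𝓝 xi, ∀ n, k ≤ n → frag i z x n = frag i z' x n) : z = z' := by
  obtain ⟨N, hN⟩ := eventually_nhds_xi_iff.1 h
  refine coord_injective <| funext fun j => ?_
  obtain ⟨n, hn, rfl⟩ := exists_index (max N k) i j
  obtain ⟨x, hx⟩ := W_nonempty n
  have hx' := hN x (EndsInXi.mono hx.2 (by omega)) (n + 1) (by omega)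
  rwa [frag, frag, twist_apply_succ_of_mem hx, twist_apply_succ_of_mem hx, add_right_inj] at hx'

theorem InBranch.unique {i : ZMod 4} {f : Pt → Pt} {z z' : ZMod 3 × ZMod 3}
    (h : InBranch f (frag i z)) (h' : InBranch f (frag i z')) : z = z' := by
  obtain ⟨k, hk⟩ := h
  obtain ⟨k', hk'⟩ := h'
  refine eq_of_eventually_frag_apply_eq (i := i) (k := max k k') ?_
  filter_upwards [hk, hk'] with x hx hx' n hn
  rw [← hx n (le_of_max_le_left hn), hx' n (le_of_max_le_right hn)]

theorem existsUnique_inBranch {i : ZMod 4} {g : Equiv.Perm Pt} (hg : g ∈ G i) :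
    ∃! h, h ∈ H i ∧ InBranch g h := by
  obtain ⟨K, z, -, hf⟩ := exists_inBranchAtLevel hg
  refine ⟨frag i z, ⟨frag_mem_H i z, hf.inBranch⟩, ?_⟩
  rintro h ⟨hh, hb⟩
  obtain ⟨z', rfl⟩ := exists_eq_frag_of_mem_H hh
  rw [hb.unique hf.inBranch]

theorem existsUnique_germ {i : ZMod 4} {g : Equiv.Perm Pt} (hg : g ∈ G i) (hxi : g xi = xi) :
    ∃! h : Equiv.Perm Pt, h ∈ H i ∧ ∀ᶠ x in 𝓝 xi, g x = h x := by
  obtain ⟨K, z, -, hf⟩ := exists_inBranchAtLevel hg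
  have hgz : ∀ᶠ x in 𝓝 xi, g x = frag i z x := eventually_nhds_xi_iff.2
    ⟨K, fun x hx => hf.eq_twist_of_endsInXi (hxi.symm ▸ endsInXi_xi K) hx⟩
  refine ⟨frag i z, ⟨frag_mem_H i z, hgz⟩, ?_⟩
  rintro h ⟨hh, hgh⟩
  obtain ⟨z', rfl⟩ := exists_eq_frag_of_mem_H hh
  refine congrArg (frag i) (eq_of_eventually_frag_apply_eq (i := i) (k := 0) ?_)
  filter_upwards [hgz, hgh] with x hx hx' n _
  rw [← hx', hx]

/-! ### Traverses -/

theorem act_append_singleton (w : List (Equiv.Perm Pt)) (s : Equiv.Perm Pt) (x : Pt) :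
    act (w ++ [s]) x = s (act w x) := by
  simp only [act, List.foldl_append, List.foldl_cons, List.foldl_nil]

theorem act_take_succ {w : List (Equiv.Perm Pt)} {j : ℕ} (hj : j < w.length) (x : Pt) :
    act (w.take (j + 1)) x = w[j] (act (w.take j) x) := by
  rw [List.take_succ_eq_append_getElem hj, act_append_singleton]

theorem EndsInEta.not_endsInXi {k : ℕ} {x : Pt} (h : EndsInEta k x) (hk : 1 ≤ k) :
    ¬EndsInXi k x := by
  obtain ⟨k, rfl⟩ := Nat.exists_eq_add_of_le' hk
  exact fun hx => hx.notMem_W k.lt_succ_self (endsInEta_succ_iff.1 h)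

theorem EndsInEta.twist_apply {k : ℕ} {x : Pt} (h : EndsInEta k x) (c : ℕ → ZMod 3) :
    EndsInEta k (twist c x) := by
  cases k with
  | zero => exact fun n hn => absurd hn n.not_lt_zero
  | succ k =>
    rw [endsInEta_succ_iff] at h ⊢
    exact (twistFun_mem_W c x k).2 h

theorem IsTraverse.start_mem {k : ℕ} {B : Set Pt} {w : List (Equiv.Perm Pt)} {x : Pt}
    (h : IsTraverse k B w x) : x ∈ B := h.stays 0 (Nat.zero_le _)

theorem IsTraverse.first_mem_zpowers {i : ZMod 4} {k : ℕ} {B : Set Pt}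
    {w : List (Equiv.Perm Pt)} {x : Pt} (h : IsTraverse k B w x) (hk : 1 ≤ k) (hw : 0 < w.length)
    (hs : w[0] ∈ Subgroup.zpowers a ∨ w[0] ∈ H i) : w[0] ∈ Subgroup.zpowers a := by
  refine hs.resolve_right fun hH => ?_
  obtain ⟨z, hz⟩ := exists_eq_frag_of_mem_H hH
  have eta_one : EndsInEta k (act (w.take 1) x) := by
    rw [act_take_succ hw, hz]
    exact h.starts.twist_apply _
  have length_le_one : w.length ≤ 1 := le_of_not_gt fun hlen => h.inside 1 one_pos hlen eta_one
  obtain ⟨j, hj, hx⟩ := h.crosses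
  obtain rfl | rfl : j = 0 ∨ j = 1 := by omega
  · exact h.starts.not_endsInXi hk hx
  · exact eta_one.not_endsInXi hk hx

/-- The word `x` with its last `k` letters replaced by those of `p`. It moves a walk on one copy
of the tile of level `k` to the copy that contains `x`. -/
def splice (k : ℕ) (p x : Pt) : Pt := fun n => if n < k then p n else x n

theorem splice_apply_of_lt {k n : ℕ} (h : n < k) (p x : Pt) : splice k p x n = p n := if_pos h

theorem splice_apply_of_le {k n : ℕ} (h : k ≤ n) (p x : Pt) : splice k p x n = x n :=
  if_neg h.not_gt

theorem splice_xi_of_mem_tile {k : ℕ} {p : Pt} (hp : p ∈ tile k) : splice k p xi = p := by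
  funext n
  rcases lt_or_ge n k with h | h
  · exact splice_apply_of_lt h p xi
  · rw [splice_apply_of_le h, hp n h, xi]

theorem inBranchAtLevel_splice (k : ℕ) (p : Pt) : InBranchAtLevel k (splice k p) 1 := fun _ _ =>
  ⟨fun _ hn => by rw [splice_apply_of_lt hn, splice_apply_of_lt hn],
    fun _ hn => splice_apply_of_le hn _ _⟩

theorem InBranchAtLevel.exists_letter_comp {i : ZMod 4} {k : ℕ} {f : Pt → Pt}
    {z : ZMod 3 × ZMod 3} (hf : InBranchAtLevel k f (frag i z)) (hk : 1 ≤ k) {s : Equiv.Perm Pt}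
    (hs : s ∈ Subgroup.zpowers a ∨ s ∈ H i)
    (heta : EndsInEta k (f xi) → s ∈ Subgroup.zpowers a) :
    ∃ z', InBranchAtLevel k (s ∘ f) (frag i z') := by
  by_cases hsa : s ∈ Subgroup.zpowers a
  · obtain ⟨e, rfl⟩ := exists_eq_rot_of_mem_zpowers hsa
    exact ⟨z, hf.rot_comp hk e⟩
  obtain ⟨d, rfl⟩ := exists_eq_frag_of_mem_H (hs.resolve_left hsa)
  by_cases hxi : EndsInXi k (f xi)
  · refine ⟨d + z, ?_⟩
    rw [← frag_mul_frag, frag, frag, twist_mul_twist]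
    exact hf.twist_comp_of_endsInXi hxi _
  · exact ⟨z, hf.twist_comp_of_not_endsIn hxi (mt heta hsa) _⟩

theorem IsTraverse.exists_inBranchAtLevel {i : ZMod 4} {k : ℕ} {w : List (Equiv.Perm Pt)} {p : Pt}
    (h : IsTraverse k (tile k) w p) (hk : 1 ≤ k)
    (hw : ∀ s ∈ w, s ∈ Subgroup.zpowers a ∨ s ∈ H i) {j : ℕ} (hj : j ≤ w.length) :
    ∃ z, InBranchAtLevel k (fun x => act (w.take j) (splice k p x)) (frag i z) := by
  induction j with
  | zero => exact ⟨0, frag_zero i ▸ inBranchAtLevel_splice k p⟩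
  | succ j ih =>
    obtain ⟨z, hz⟩ := ih (Nat.le_of_succ_le hj)
    have hsj := hw _ (List.getElem_mem hj)
    simp only [act_take_succ hj]
    refine hz.exists_letter_comp hk hsj fun heta => ?_
    rw [splice_xi_of_mem_tile h.start_mem] at heta
    rcases Nat.eq_zero_or_pos j with rfl | hpos
    · exact h.first_mem_zpowers hk hj hsj
    · exact absurd heta (h.inside j hpos hj)

theorem eventually_eq_splice {i : ZMod 4} {k : ℕ} {t : Equiv.Perm Pt} (ht : t ∈ G i)
    (hb : InBranch t 1) (htile : t xi ∈ tile k) : ∀ᶠ x in 𝓝 xi, t x = splice k (t xi) x := by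
  obtain ⟨K, z, -, hf⟩ := exists_inBranchAtLevel ht
  obtain rfl : z = 0 := hf.inBranch.unique (frag_zero i ▸ hb)
  refine eventually_nhds_xi_iff.2 ⟨max K k, fun x hx => funext fun n => ?_⟩
  rw [frag_zero, ← twist_zero] at hf
  obtain ⟨hlow, hhigh⟩ := hf.mono (le_max_left K k) x hx
  rcases lt_or_ge n k with hn | hn
  · rw [splice_apply_of_lt hn, hlow n (lt_max_of_lt_right hn)]
  rw [splice_apply_of_le hn]
  rcases lt_or_ge n (max K k) with hnK | hnK
  · rw [hlow n hnK, htile n hn, hx n hnK]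
  · rw [hhigh n hnK, twist_zero, Equiv.Perm.one_apply]

/-! ### Bridges -/

theorem splice_xi_mem_W {k m : ℕ} {u y : Pt} (hkm : k ≤ m) (hy : y ∈ bridge k m u) :
    splice k xi y ∈ W m := by
  refine ⟨(splice_apply_of_le hkm xi y).trans hy.2.1, fun n hn => ?_⟩
  rcases lt_or_ge n k with hnk | hnk
  · exact splice_apply_of_lt hnk xi y
  · rw [splice_apply_of_le hnk, hy.1 n hnk hn]

theorem splice_splice {k : ℕ} (p q x : Pt) : splice k p (splice k q x) = splice k p x := by
  funext n
  simp only [splice]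
  split_ifs <;> rfl

theorem EndsInEta.splice_eq {k : ℕ} {p x : Pt} (hp : EndsInEta k p) (hx : EndsInEta k x) :
    splice k p x = x := by
  funext n
  rcases lt_or_ge n k with hn | hn
  · rw [splice_apply_of_lt hn, hp n hn, hx n hn]
  · exact splice_apply_of_le hn p x

theorem splice_update_splice {k m : ℕ} (hkm : k ≤ m) (p q x : Pt) (c : ZMod 3) :
    splice k p (Function.update (splice k q x) m c) = Function.update (splice k p x) m c := by
  funext n
  rcases eq_or_ne n m with rfl | hn
  · rw [splice_apply_of_le hkm, Function.update_self, Function.update_self]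
  · simp only [splice, Function.update_of_ne hn]
    split_ifs <;> rfl

theorem update_splice_mem_bridge {k m : ℕ} {u y : Pt} (hkm : k ≤ m) (hy : y ∈ bridge k m u)
    (p : Pt) (c : ZMod 3) : Function.update (splice k p y) (m + 1) c ∈ bridge k m u := by
  have apply_eq : ∀ n, k ≤ n → n ≠ m + 1 →
      Function.update (splice k p y) (m + 1) c n = y n := fun n hkn hn => by
    rw [Function.update_of_ne hn, splice_apply_of_le hkn]
  exact ⟨fun n hkn hnm => (apply_eq n hkn (by omega)).trans (hy.1 n hkn hnm),
    (apply_eq m hkm (by omega)).trans hy.2.1,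
    fun n hn => (apply_eq n (by omega) (by omega)).trans (hy.2.2 n hn)⟩

theorem InBranchAtLevel.apply_splice_xi {i : ZMod 4} {k m : ℕ} {u y : Pt} {f : Pt → Pt}
    {z : ZMod 3 × ZMod 3} (hf : InBranchAtLevel k f (frag i z)) (hkm : k ≤ m)
    (hy : y ∈ bridge k m u) :
    f (splice k xi y) =
      Function.update (splice k (f xi) y) (m + 1) (y (m + 1) + coord z (i + m)) := by
  have hW := splice_xi_mem_W hkm hy
  obtain ⟨hlow, hhigh⟩ := hf _ (EndsInXi.mono hW.2 hkm)
  rw [← splice_update_splice (hkm.trans m.le_succ) (f xi) xi]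
  funext n
  rcases lt_or_ge n k with hn | hn
  · rw [hlow n hn, splice_apply_of_lt hn]
  · rw [hhigh n hn, splice_apply_of_le hn, frag, twist_apply_of_mem_W hW,
      splice_apply_of_le (hkm.trans m.le_succ)]

theorem IsTraverse.exists_act_eq {i : ZMod 4} {k m : ℕ} {w : List (Equiv.Perm Pt)} {p u x : Pt}
    (h : IsTraverse k (tile k) w p) (hk : 1 ≤ k)
    (hw : ∀ s ∈ w, s ∈ Subgroup.zpowers a ∨ s ∈ H i) (hkm : k ≤ m) (hx : x ∈ bridge k m u)
    (heta : EndsInEta k x) {j : ℕ} (hj : j ≤ w.length) :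
    ∃ z, InBranchAtLevel k (fun x => act (w.take j) (splice k p x)) (frag i z) ∧
      act (w.take j) x = Function.update (splice k (act (w.take j) p) x) (m + 1)
        (x (m + 1) + coord z (i + m)) := by
  obtain ⟨z, hz⟩ := h.exists_inBranchAtLevel hk hw hj
  refine ⟨z, hz, ?_⟩
  have hact := hz.apply_splice_xi hkm hx
  rwa [splice_splice, h.starts.splice_eq heta,
    splice_xi_of_mem_tile h.start_mem] at hact

theorem IsTraverse.bridge {i : ZMod 4} {k m : ℕ} {w : List (Equiv.Perm Pt)} {p u x : Pt}
    (h : IsTraverse k (tile k) w p) (hk : 1 ≤ k)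
    (hw : ∀ s ∈ w, s ∈ Subgroup.zpowers a ∨ s ∈ H i) (hkm : k ≤ m) (hx : x ∈ bridge k m u)
    (heta : EndsInEta k x) : IsTraverse k (bridge k m u) w x := by
  have act_apply : ∀ j ≤ w.length, ∀ n < k, act (w.take j) p n = act (w.take j) x n := by
    intro j hj n hn
    obtain ⟨z, -, hz⟩ := h.exists_act_eq hk hw hkm hx heta hj
    rw [hz, Function.update_of_ne (by omega), splice_apply_of_lt hn]
  refine ⟨fun j hj => ?_, heta, ?_, fun j hpos hj heta_j => ?_, ?_⟩
  · obtain ⟨z, -, hz⟩ := h.exists_act_eq hk hw hkm hx heta hj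
    exact hz ▸ update_splice_mem_bridge hkm hx _ _
  · exact h.ends.congr (by simpa only [List.take_length] using act_apply _ le_rfl)
  · exact h.inside j hpos hj (heta_j.congr fun n hn => (act_apply j hj.le n hn).symm)
  · obtain ⟨j, hj, hxi⟩ := h.crosses
    exact ⟨j, hj, hxi.congr (act_apply j hj)⟩

theorem IsTraverseOfType.passesConnector {i : ZMod 4} {k : ℕ} {w : List (Equiv.Perm Pt)}
    {z : ZMod 3 × ZMod 3} (h : IsTraverseOfType i k w (frag i z)) (hk : 1 ≤ k) (j : ZMod 4) :
    PassesConnector i k j w (coord z j) := by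
  obtain ⟨hw, t, ht, hbt, htr, hbw⟩ := h
  rintro m hkm rfl u x hx heta
  refine ⟨htr.bridge hk hw hkm hx heta, ?_⟩
  obtain ⟨z', hz', hact⟩ := htr.exists_act_eq hk hw hkm hx heta le_rfl
  simp only [List.take_length] at hz' hact
  have hbw' : InBranch (fun x => act w (splice k (t xi) x)) (frag i z) := by
    obtain ⟨l, hl⟩ := hbw
    refine ⟨l, ?_⟩
    filter_upwards [hl, eventually_eq_splice ht hbt htr.start_mem] with x hx htx
    rwa [← htx]
  rw [hact, htr.ends.splice_eq heta, hz'.inBranch.unique hbw']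

theorem exists_mem_bridge_endsInEta {k m : ℕ} (hkm : k ≤ m) :
    ∃ x ∈ bridge k m xi, EndsInEta k x := by
  refine ⟨fun n => if n + 1 = k ∨ n = m then 0 else 2, ⟨fun n hn hnm => if_neg (by omega),
    if_pos (Or.inr rfl), fun n hn => if_neg (by omega)⟩, fun n hn => ?_⟩
  simp only [hn.trans_le hkm |>.ne, or_false]

theorem PassesConnector.unique {i j : ZMod 4} {k : ℕ} {w : List (Equiv.Perm Pt)} {c c' : ZMod 3}
    (h : PassesConnector i k j w c) (h' : PassesConnector i k j w c') : c = c' := by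
  obtain ⟨m, hkm, hm⟩ := exists_index k i j
  obtain ⟨x, hx, heta⟩ := exists_mem_bridge_endsInEta hkm
  have hact := (h m hkm hm xi x hx heta).2.symm.trans (h' m hkm hm xi x hx heta).2
  exact add_left_cancel (Function.update_injective x (m + 1) hact)

theorem exists_coord_eq_zero (z : ZMod 3 × ZMod 3) : ∃ j, coord z j = 0 := by
  by_cases hz : z = 0
  · exact ⟨0, hz ▸ coord_zero 0⟩
  · exact (existsUnique_coord_eq_zero hz).exists

theorem IsTraverseOfType.exists_ne_passesConnector_zero {i j : ZMod 4} {k : ℕ}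
    {w : List (Equiv.Perm Pt)} {z : ZMod 3 × ZMod 3} {c : ZMod 3}
    (h : IsTraverseOfType i k w (frag i z)) (hk : 1 ≤ k) (hc : c ≠ 0)
    (hj : PassesConnector i k j w c) : ∃ j', j' ≠ j ∧ PassesConnector i k j' w 0 := by
  obtain ⟨j', hj'⟩ := exists_coord_eq_zero z
  have hpass : PassesConnector i k j' w 0 := hj' ▸ h.passesConnector hk j'
  exact ⟨j', fun hjj' => hc (hj.unique (hjj' ▸ hpass)), hpass⟩

/-! ### Weights -/

/-- The weight of the letter `rot e`. -/
def rotWeight (e : ZMod 3) : ℕ := if e = 0 then 0 else 4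

/-- The weight of the letter `frag i z`. It depends on the distance, in cyclic order, from `i` to
the connector at which `z` vanishes. This distance drops by one, and is reset when it is `0`, as
`i` is replaced with `i + 1` in the wreath recursion, so the four weights follow each other
through the contraction inequality `rotWeight_add_fragWeight_le`. -/
def fragWeight (i : ZMod 4) (z : ZMod 3 × ZMod 3) : ℕ :=
  if z = 0 then 0 else if coord z i = 0 then 3 else if coord z (i + 1) = 0 then 4
  else if coord z (i + 2) = 0 then 5 else 6

theorem rotWeight_add_le : ∀ d e, rotWeight (d + e) ≤ rotWeight d + rotWeight e := by decide

theorem fragWeight_add_le : ∀ i z z', fragWeight i (z + z') ≤ fragWeight i z + fragWeight i z' := by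
  decide

theorem rotWeight_add_fragWeight_le : ∀ i z,
    10 * (rotWeight (coord z i) + fragWeight (i + 1) z) ≤ 9 * (4 + fragWeight i z) := by
  decide

theorem rotWeight_pos {e : ZMod 3} (he : e ≠ 0) : 0 < rotWeight e := by
  rw [rotWeight, if_neg he]
  norm_num

theorem fragWeight_zero (i : ZMod 4) : fragWeight i 0 = 0 := if_pos rfl

theorem fragWeight_pos {i : ZMod 4} {z : ZMod 3 × ZMod 3} (hz : z ≠ 0) : 0 < fragWeight i z := by
  rw [fragWeight, if_neg hz]
  split_ifs <;> norm_num

/-- `HasWeightLE i n g` says that `g` is a product of letters `rot e` and `frag i z` of total weight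
at most `n`. -/
inductive HasWeightLE (i : ZMod 4) : ℕ → Equiv.Perm Pt → Prop
  | one (n : ℕ) : HasWeightLE i n 1
  | rot_mul {n : ℕ} {g : Equiv.Perm Pt} (e : ZMod 3) :
      HasWeightLE i n g → HasWeightLE i (n + rotWeight e) (rot e * g)
  | frag_mul {n : ℕ} {g : Equiv.Perm Pt} (z : ZMod 3 × ZMod 3) :
      HasWeightLE i n g → HasWeightLE i (n + fragWeight i z) (frag i z * g)

namespace HasWeightLE

variable {i : ZMod 4} {m n : ℕ} {g h : Equiv.Perm Pt}

theorem mono (hg : HasWeightLE i m g) (hmn : m ≤ n) : HasWeightLE i n g := by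
  obtain ⟨k, rfl⟩ := Nat.exists_eq_add_of_le hmn
  clear hmn
  induction hg with
  | one => exact one _
  | rot_mul e _ ih => exact add_right_comm _ k _ ▸ ih.rot_mul e
  | frag_mul z _ ih => exact add_right_comm _ k _ ▸ ih.frag_mul z

theorem mul (hg : HasWeightLE i m g) (hh : HasWeightLE i n h) : HasWeightLE i (m + n) (g * h) := by
  induction hg with
  | one => exact (one_mul h).symm ▸ hh.mono (Nat.le_add_left _ _)
  | rot_mul e _ ih => exact mul_assoc (rot e) _ h ▸ add_right_comm _ n _ ▸ ih.rot_mul e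
  | frag_mul z _ ih => exact mul_assoc (frag i z) _ h ▸ add_right_comm _ n _ ▸ ih.frag_mul z

theorem exists_of_mem_G (hg : g ∈ G i) : ∃ n, HasWeightLE i n g := by
  induction hg using G_induction with
  | one => exact ⟨0, one 0⟩
  | rot_mul e g _ ih => exact ih.imp' _ fun _ => rot_mul e
  | frag_mul z g _ ih => exact ih.imp' _ fun _ => frag_mul z

theorem eq_one_or_exists_lt (hg : HasWeightLE i n g) :
    g = 1 ∨ ∃ m < n, ∃ g', HasWeightLE i m g' ∧
      ((∃ e, g = rot e * g') ∨ ∃ z, g = frag i z * g') := by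
  induction hg with
  | one => exact .inl rfl
  | @rot_mul n g e hg ih =>
    rcases eq_or_ne e 0 with rfl | he
    · simpa only [rotWeight, if_true, add_zero, rot_zero, one_mul] using ih
    · exact .inr ⟨n, Nat.lt_add_of_pos_right (rotWeight_pos he), g, hg, .inl ⟨e, rfl⟩⟩
  | @frag_mul n g z hg ih =>
    rcases eq_or_ne z 0 with rfl | hz
    · simpa only [fragWeight_zero, add_zero, frag_zero, one_mul] using ih
    · exact .inr ⟨n, Nat.lt_add_of_pos_right (fragWeight_pos hz), g, hg, .inr ⟨z, rfl⟩⟩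

end HasWeightLE

theorem hasWeightLE_rot (i : ZMod 4) (e : ZMod 3) : HasWeightLE i (rotWeight e) (rot e) := by
  simpa only [zero_add, mul_one] using (HasWeightLE.one (i := i) 0).rot_mul e

theorem hasWeightLE_frag (i : ZMod 4) (z : ZMod 3 × ZMod 3) :
    HasWeightLE i (fragWeight i z) (frag i z) := by
  simpa only [zero_add, mul_one] using (HasWeightLE.one (i := i) 0).frag_mul z

/-- The ball of radius `n` of `G i` with respect to the weights of the letters. -/
def ball (i : ZMod 4) (n : ℕ) : Set (Equiv.Perm Pt) := {g | HasWeightLE i n g}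

theorem ball_mono (i : ZMod 4) : Monotone (ball i) := fun _ _ hmn _ hg => HasWeightLE.mono hg hmn

theorem finite_ball (i : ZMod 4) (n : ℕ) : (ball i n).Finite := by
  induction n using Nat.strong_induction_on with
  | _ n ih =>
    have hlt : (⋃ m ∈ Set.Iio n, ball i m).Finite := (Set.finite_Iio n).biUnion ih
    refine ((Set.finite_singleton 1).union (((Set.finite_range rot).union
      (Set.finite_range (frag i))).mul hlt)).subset fun g hg => ?_
    rcases HasWeightLE.eq_one_or_exists_lt hg with rfl | ⟨m, hm, g', hg', hgg'⟩
    · exact .inl rfl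
    · have hg'_mem : g' ∈ ⋃ m ∈ Set.Iio n, ball i m := Set.mem_biUnion hm hg'
      rcases hgg' with ⟨e, rfl⟩ | ⟨z, rfl⟩
      · exact .inr (Set.mul_mem_mul (.inl ⟨e, rfl⟩) hg'_mem)
      · exact .inr (Set.mul_mem_mul (.inr ⟨z, rfl⟩) hg'_mem)

/-! ### Contraction of the weights -/

/-- The transformations whose action on the last letter is `σ` and whose section at each letter `y`
belongs to `A y`. -/
def withSections (σ : Equiv.Perm (ZMod 3)) (A : ZMod 3 → Set (Equiv.Perm Pt)) :
    Set (Equiv.Perm Pt) :=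
  {g | ∀ y, ∃ s ∈ A y, ∀ v, g (snoc v y) = snoc (s v) (σ y)}

/-- The weights of the sections `(a ^ coord z i, Id, frag (i + 1) z)` of `frag i z`. -/
def fragSectionWeight (i : ZMod 4) (z : ZMod 3 × ZMod 3) : ZMod 3 → ℕ :=
  ![rotWeight (coord z i), 0, fragWeight (i + 1) z]

theorem frag_mem_withSections (i : ZMod 4) (z : ZMod 3 × ZMod 3) :
    frag i z ∈ withSections 1 (fun y => ball (i + 1) (fragSectionWeight i z y)) := by
  intro y
  fin_cases y
  · exact ⟨_, hasWeightLE_rot (i + 1) _, frag_snoc_zero i z⟩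
  · exact ⟨1, .one _, frag_snoc_one i z⟩
  · exact ⟨_, hasWeightLE_frag (i + 1) z, frag_snoc_two i z⟩

/-- The sections of `g ∈ G i` at the three letters have total weight at most `9 / 10 * n`. -/
def HasLightSections (i : ZMod 4) (n : ℕ) (g : Equiv.Perm Pt) : Prop :=
  ∃ (σ : Equiv.Perm (ZMod 3)) (r : ZMod 3 → ℕ),
    g ∈ withSections σ (fun y => ball (i + 1) (r y)) ∧ 10 * ∑ y, r y ≤ 9 * n

namespace HasLightSections

variable {i : ZMod 4} {n : ℕ} {g : Equiv.Perm Pt}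

theorem one (i : ZMod 4) (n : ℕ) : HasLightSections i n 1 :=
  ⟨1, 0, fun _ => ⟨1, .one _, fun _ => rfl⟩, by simp⟩

theorem mono {m : ℕ} (hg : HasLightSections i m g) (hmn : m ≤ n) : HasLightSections i n g := by
  obtain ⟨σ, r, hσ, hr⟩ := hg
  exact ⟨σ, r, hσ, hr.trans (Nat.mul_le_mul_left 9 hmn)⟩

theorem rot_mul (hg : HasLightSections i n g) (e : ZMod 3) : HasLightSections i n (rot e * g) := by
  obtain ⟨σ, r, hσ, hr⟩ := hg
  refine ⟨σ.trans (Equiv.addRight e), r, fun y => ?_, hr⟩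
  obtain ⟨s, hs, hsv⟩ := hσ y
  exact ⟨s, hs, fun v => by
    rw [Equiv.Perm.mul_apply, hsv, rot_snoc, Equiv.trans_apply, Equiv.coe_addRight]⟩

theorem frag_mul (hg : HasLightSections i n g) (z : ZMod 3 × ZMod 3) :
    HasLightSections i (n + (4 + fragWeight i z)) (frag i z * g) := by
  obtain ⟨σ, r, hσ, hr⟩ := hg
  refine ⟨σ, fun y => fragSectionWeight i z (σ y) + r y, fun y => ?_, ?_⟩
  · obtain ⟨s, hs, hsv⟩ := hσ y
    obtain ⟨s', hs', hsv'⟩ := frag_mem_withSections i z (σ y)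
    exact ⟨s' * s, HasWeightLE.mul hs' hs, fun v => by
      rw [Equiv.Perm.mul_apply, hsv, hsv', Equiv.Perm.mul_apply, Equiv.Perm.one_apply]⟩
  · have hsum : ∑ y, fragSectionWeight i z (σ y) =
        rotWeight (coord z i) + fragWeight (i + 1) z := by
      rw [Equiv.sum_comp σ]
      exact (Fin.sum_univ_three (fragSectionWeight i z)).trans rfl
    rw [Finset.sum_add_distrib, hsum]
    linarith [rotWeight_add_fragWeight_le i z]

end HasLightSections

/-- Among the syllables `rot e * frag i z` of `g`, all but the first one have `e ≠ 0`, so the weight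
of `rot e` pays for the `4` in `HasLightSections.frag_mul`. -/
theorem HasWeightLE.exists_eq_rot_mul_frag_mul {i : ZMod 4} {n : ℕ} {g : Equiv.Perm Pt}
    (hg : HasWeightLE i n g) : ∃ e z g' m, g = rot e * (frag i z * g') ∧
      HasLightSections i m g' ∧ rotWeight e + fragWeight i z + m ≤ n := by
  induction hg with
  | one n => exact ⟨0, 0, 1, n, by rw [rot_zero, frag_zero, mul_one, mul_one], .one i n,
      by rw [fragWeight_zero, rotWeight, if_pos rfl, zero_add, zero_add]⟩
  | rot_mul d _ ih =>
    obtain ⟨e, z, g', m, rfl, hg', hle⟩ := ih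
    exact ⟨d + e, z, g', m, by rw [← mul_assoc, rot_mul_rot], hg',
      by linarith [rotWeight_add_le d e]⟩
  | frag_mul d _ ih =>
    obtain ⟨e, z, g', m, rfl, hg', hle⟩ := ih
    rcases eq_or_ne e 0 with rfl | he
    · exact ⟨0, d + z, g', m, by rw [rot_zero, one_mul, one_mul, ← mul_assoc, frag_mul_frag], hg',
        by linarith [fragWeight_add_le i d z]⟩
    · have he4 : rotWeight e = 4 := if_neg he
      exact ⟨0, d, _, _, by rw [rot_zero, one_mul], (hg'.frag_mul z).rot_mul e, by
        rw [rotWeight, if_pos rfl]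
        linarith⟩

theorem hasLightSections_of_mem_ball {i : ZMod 4} {n : ℕ} {g : Equiv.Perm Pt}
    (hg : g ∈ ball i n) : HasLightSections i (n + 4) g := by
  obtain ⟨e, z, g', m, rfl, hg', hle⟩ := HasWeightLE.exists_eq_rot_mul_frag_mul hg
  exact ((hg'.frag_mul z).rot_mul e).mono (by linarith)

/-! ### The growth recursion -/

section Sections

variable {σ : Equiv.Perm (ZMod 3)} {A : ZMod 3 → Set (Equiv.Perm Pt)}

theorem exists_injective_withSections (σ : Equiv.Perm (ZMod 3)) (A : ZMod 3 → Set (Equiv.Perm Pt)) :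
    ∃ F : withSections σ A → ∀ y, A y, Function.Injective F := by
  choose s hs hsv using fun g : withSections σ A => g.2
  refine ⟨fun g y => ⟨s g y, hs g y⟩, fun g g' hgg' => Subtype.ext (perm_ext_snoc fun v y => ?_)⟩
  have hs_eq : s g y = s g' y := congrArg Subtype.val (congrFun hgg' y)
  rw [hsv, hsv, hs_eq]

theorem finite_withSections (hA : ∀ y, (A y).Finite) : (withSections σ A).Finite := by
  have := fun y => (hA y).to_subtype
  obtain ⟨F, hF⟩ := exists_injective_withSections σ A
  exact Finite.of_injective F hF

theorem ncard_withSections_le (hA : ∀ y, (A y).Finite) :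
    (withSections σ A).ncard ≤ ∏ y, (A y).ncard := by
  have := fun y => (hA y).to_subtype
  obtain ⟨F, hF⟩ := exists_injective_withSections σ A
  exact (Nat.card_le_card_of_injective F hF).trans_eq Nat.card_pi

end Sections

theorem ncard_ball_le (i : ZMod 4) (n : ℕ) :
    (ball i n).ncard ≤ ∑ _σ : Equiv.Perm (ZMod 3),
      ∑ r ∈ Fintype.piFinset (fun _ : ZMod 3 => Finset.range (n + 4)) with
        10 * ∑ y, r y ≤ 9 * (n + 4), ∏ y, (ball (i + 1) (r y)).ncard := by
  set I := {r ∈ Fintype.piFinset (fun _ : ZMod 3 => Finset.range (n + 4)) |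
    10 * ∑ y, r y ≤ 9 * (n + 4)} with hI
  have hfin : ∀ r : ZMod 3 → ℕ, ∀ y, (ball (i + 1) (r y)).Finite := fun r y => finite_ball _ _
  have hsub : ball i n ⊆ ⋃ p ∈ Finset.univ ×ˢ I,
      withSections p.1 (fun y => ball (i + 1) (p.2 y)) := by
    intro g hg
    obtain ⟨σ, r, hσ, hr⟩ := hasLightSections_of_mem_ball hg
    refine Set.mem_biUnion (x := (σ, r)) ?_ hσ
    rw [Finset.mem_coe, Finset.mem_product, hI, Finset.mem_filter, Fintype.mem_piFinset]
    refine ⟨Finset.mem_univ σ, fun y => Finset.mem_range.2 ?_, hr⟩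
    have hry : r y ≤ ∑ y, r y := Finset.single_le_sum (fun _ _ => Nat.zero_le _) (Finset.mem_univ y)
    dsimp only
    omega
  rw [← Finset.sum_product' Finset.univ I fun _ r => ∏ y, (ball (i + 1) (r y)).ncard]
  calc (ball i n).ncard
      ≤ (⋃ p ∈ Finset.univ ×ˢ I, withSections p.1 (fun y => ball (i + 1) (p.2 y))).ncard :=
        Set.ncard_le_ncard hsub
          (Set.Finite.biUnion (Finset.finite_toSet _) fun p _ => finite_withSections (hfin p.2))
    _ ≤ ∑ p ∈ Finset.univ ×ˢ I, (withSections p.1 fun y => ball (i + 1) (p.2 y)).ncard :=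
        Finset.set_ncard_biUnion_le _ _
    _ ≤ ∑ p ∈ Finset.univ ×ˢ I, ∏ y, (ball (i + 1) (p.2 y)).ncard :=
        Finset.sum_le_sum fun p _ => ncard_withSections_le (hfin p.2)

theorem ncard_ball_le_of_forall_prod_le {i : ZMod 4} {n : ℕ} {B : ℝ}
    (hB : ∀ r : ZMod 3 → ℕ, ∑ y, (r y : ℝ) ≤ 9 / 10 * (n + 4) →
      ∏ y, ((ball (i + 1) (r y)).ncard : ℝ) ≤ B) :
    ((ball i n).ncard : ℝ) ≤ 6 * ((n : ℝ) + 4) ^ 3 * B := by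
  have hB0 : 0 ≤ B := le_trans (Finset.prod_nonneg fun _ _ => Nat.cast_nonneg _)
    (hB 0 (by simp only [Pi.zero_apply, Nat.cast_zero, Finset.sum_const_zero]; positivity))
  set I := {r ∈ Fintype.piFinset (fun _ : ZMod 3 => Finset.range (n + 4)) |
    10 * ∑ y, r y ≤ 9 * (n + 4)}
  have hI_card : (I.card : ℝ) ≤ ((n : ℝ) + 4) ^ 3 := by
    have hle : I.card ≤ (n + 4) ^ 3 := by
      refine (Finset.card_filter_le _ _).trans_eq ?_
      rw [Fintype.card_piFinset, Finset.prod_const, Finset.card_range, Finset.card_univ, ZMod.card]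
    exact_mod_cast hle
  have hI_prod : ∀ r ∈ I, ∏ y, ((ball (i + 1) (r y)).ncard : ℝ) ≤ B := by
    intro r hr
    have hr' : (10 : ℝ) * ∑ y, (r y : ℝ) ≤ 9 * (n + 4) := by
      exact_mod_cast (Finset.mem_filter.1 hr).2
    exact hB r (by linarith)
  have hperm : Fintype.card (Equiv.Perm (ZMod 3)) = 6 := Fintype.card_perm
  calc ((ball i n).ncard : ℝ)
      ≤ ∑ _σ : Equiv.Perm (ZMod 3), ∑ r ∈ I, ∏ y, ((ball (i + 1) (r y)).ncard : ℝ) := by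
        exact_mod_cast ncard_ball_le i n
    _ = 6 * ∑ r ∈ I, ∏ y, ((ball (i + 1) (r y)).ncard : ℝ) := by
        rw [Finset.sum_const, Finset.card_univ, hperm, nsmul_eq_mul, Nat.cast_ofNat]
    _ ≤ 6 * (I.card * B) := by
        rw [← nsmul_eq_mul]
        gcongr
        exact Finset.sum_le_card_nsmul I _ B hI_prod
    _ ≤ 6 * ((n + 4) ^ 3 * B) := by gcongr
    _ = 6 * ((n : ℝ) + 4) ^ 3 * B := (mul_assoc _ _ _).symm

/-! ### Functions growing according to a contracting recursion -/

section Recursion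

theorem sum_rpow_le_card_rpow_mul_sum_rpow {Y : Type*} [Fintype Y] [Nonempty Y] {β : ℝ}
    (hβ0 : 0 ≤ β) (hβ1 : β ≤ 1) {x : Y → ℝ} (hx : ∀ y, 0 ≤ x y) :
    ∑ y, x y ^ β ≤ (Fintype.card Y : ℝ) ^ (1 - β) * (∑ y, x y) ^ β := by
  have hd : (0 : ℝ) < Fintype.card Y := Nat.cast_pos.2 Fintype.card_pos
  have hjensen := (Real.concaveOn_rpow hβ0 hβ1).le_map_sum (t := Finset.univ)
    (w := fun _ : Y => (Fintype.card Y : ℝ)⁻¹) (p := x) (fun _ _ => by positivity)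
    (by rw [Finset.sum_const, Finset.card_univ, nsmul_eq_mul, mul_inv_cancel₀ hd.ne'])
    (fun y _ => hx y)
  simp only [smul_eq_mul, ← Finset.mul_sum] at hjensen
  rw [Real.mul_rpow (by positivity) (Finset.sum_nonneg fun y _ => hx y), Real.inv_rpow hd.le,
    inv_mul_le_iff₀ hd] at hjensen
  rwa [Real.rpow_sub hd, Real.rpow_one, div_eq_mul_inv, mul_assoc]

/-- The exponent `β` at which `d ^ (1 - β) * lam ^ β = 1`: a function growing according to a
recursion with `d` branches whose total size is contracted by `lam` is at most `exp (C * n ^ β)`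
for every larger `β`. -/
noncomputable def contractionExponent (d lam : ℝ) : ℝ := Real.log d / (Real.log d - Real.log lam)

section Exponent

variable {d lam : ℝ}

theorem log_sub_log_pos (hd : 1 < d) (hlam0 : 0 < lam) (hlam1 : lam < 1) :
    0 < Real.log d - Real.log lam := by
  linarith [Real.log_pos hd, Real.log_neg hlam0 hlam1]

theorem contractionExponent_pos (hd : 1 < d) (hlam0 : 0 < lam) (hlam1 : lam < 1) :
    0 < contractionExponent d lam :=
  div_pos (Real.log_pos hd) (log_sub_log_pos hd hlam0 hlam1)

theorem contractionExponent_lt_one (hd : 1 < d) (hlam0 : 0 < lam) (hlam1 : lam < 1) :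
    contractionExponent d lam < 1 := by
  rw [contractionExponent, div_lt_one (log_sub_log_pos hd hlam0 hlam1)]
  linarith [Real.log_neg hlam0 hlam1]

theorem contractionExponent_lt {lam' : ℝ} (hd : 1 < d) (hlam0 : 0 < lam) (hlam : lam < lam')
    (hlam1 : lam' < 1) : contractionExponent d lam < contractionExponent d lam' :=
  div_lt_div_of_pos_left (Real.log_pos hd) (log_sub_log_pos hd (hlam0.trans hlam) hlam1)
    (sub_lt_sub_left (Real.log_lt_log hlam0 hlam) _)

theorem rpow_one_sub_mul_rpow_lt_one {β : ℝ} (hd : 1 < d) (hlam0 : 0 < lam) (hlam1 : lam < 1)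
    (hβ : contractionExponent d lam < β) : d ^ (1 - β) * lam ^ β < 1 := by
  rw [contractionExponent, div_lt_iff₀ (log_sub_log_pos hd hlam0 hlam1)] at hβ
  rw [Real.rpow_def_of_pos (by linarith), Real.rpow_def_of_pos hlam0, ← Real.exp_add,
    Real.exp_lt_one_iff]
  linarith

end Exponent

variable {β lam c d : ℝ} {u : ℕ → ℝ}

theorem eventually_abs_add_mul_rpow_le (hβ0 : 0 < β) (hlam : 0 ≤ lam) (hc : 0 ≤ c) (hd : 0 ≤ d)
    (hθ : d ^ (1 - β) * lam ^ β < 1) (hu : u =o[atTop] fun n : ℕ => (n : ℝ) ^ β) :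
    ∀ᶠ n : ℕ in atTop, |u n| + d ^ (1 - β) * (lam * (n + c) + d) ^ β ≤ ((n : ℝ) + 1) ^ β := by
  have hsucc : Tendsto (fun n : ℕ => (n : ℝ) + 1) atTop atTop :=
    tendsto_atTop_add_const_right _ _ tendsto_natCast_atTop_atTop
  have hratio : Tendsto (fun n : ℕ => (lam * (n + c) + d) / ((n : ℝ) + 1)) atTop (𝓝 lam) := by
    have hlim := tendsto_const_nhds (x := lam).add
      ((tendsto_const_nhds (x := lam * (c - 1) + d)).div_atTop hsucc)
    rw [add_zero] at hlim
    refine hlim.congr fun n => ?_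
    field_simp
    ring
  have hu_succ : Tendsto (fun n : ℕ => |u n| / ((n : ℝ) + 1) ^ β) atTop (𝓝 0) := by
    refine (hu.norm_left.trans_isBigO
      (Asymptotics.IsBigO.of_norm_le fun n => ?_)).tendsto_div_nhds_zero
    rw [Real.norm_of_nonneg (by positivity)]
    gcongr
    linarith
  have hsum := hu_succ.add ((hratio.rpow_const (.inr hβ0.le)).const_mul (d ^ (1 - β)))
  rw [zero_add] at hsum
  filter_upwards [hsum.eventually_le_const hθ] with n hn
  rwa [Real.div_rpow (by positivity) (by positivity), ← mul_div_assoc, ← add_div,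
    div_le_one (by positivity)] at hn

theorem eventually_mul_add_lt (hlam1 : lam < 1) (c : ℝ) :
    ∀ᶠ n : ℕ in atTop, lam * (n + c) < n := by
  filter_upwards [tendsto_natCast_atTop_atTop.eventually_gt_atTop (lam * c / (1 - lam))] with n hn
  rw [div_lt_iff₀ (by linarith)] at hn
  linarith

variable {ι Y : Type*} [Fintype Y] [Nonempty Y] {τ : ι → ι} {f : ι → ℕ → ℝ}

theorem prod_exp_mul_rpow_le {C s : ℝ} (hβ0 : 0 ≤ β) (hβ1 : β ≤ 1) (hC : 0 ≤ C) {x : Y → ℝ}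
    (hx : ∀ y, 0 ≤ x y) (hs : ∑ y, x y ≤ s) :
    ∏ y, Real.exp (C * x y ^ β) ≤
      Real.exp (C * ((Fintype.card Y : ℝ) ^ (1 - β) * s ^ β)) := by
  rw [← Real.exp_sum, ← Finset.mul_sum]
  gcongr
  refine (sum_rpow_le_card_rpow_mul_sum_rpow hβ0 hβ1 hx).trans ?_
  gcongr
  exact Finset.sum_nonneg fun y _ => hx y

theorem prod_le_exp_of_sum_le {F : ℕ → ℝ} {C s : ℝ} {n : ℕ} (hβ0 : 0 ≤ β) (hβ1 : β ≤ 1) (hC : 0 ≤ C)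
    (hF0 : ∀ m, 0 ≤ F m) (hF : ∀ m < n, F m ≤ Real.exp (C * ((m : ℝ) + 1) ^ β)) (hs : s < n)
    {r : Y → ℕ} (hr : ∑ y, (r y : ℝ) ≤ s) :
    ∏ y, F (r y) ≤
      Real.exp (C * ((Fintype.card Y : ℝ) ^ (1 - β) * (s + Fintype.card Y) ^ β)) := by
  have hlt : ∀ y, r y < n := fun y => Nat.cast_lt.1 (lt_of_le_of_lt
    (Finset.single_le_sum (fun y _ => Nat.cast_nonneg (r y)) (Finset.mem_univ y)) (hr.trans_lt hs))
  have hsum : ∑ y, ((r y : ℝ) + 1) ≤ s + Fintype.card Y := by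
    rwa [Finset.sum_add_distrib, Finset.sum_const, Finset.card_univ, nsmul_one,
      add_le_add_iff_right]
  exact (Finset.prod_le_prod (fun y _ => hF0 _) fun y _ => hF _ (hlt y)).trans
    (prod_exp_mul_rpow_le hβ0 hβ1 hC (fun y => by positivity) hsum)

theorem exists_forall_le_exp_of_contracting [Finite ι] (hf : ∀ i n, 0 ≤ f i n)
    (hβ0 : 0 < β) (hβ1 : β ≤ 1) (hlam0 : 0 ≤ lam) (hlam1 : lam < 1) (hc : 0 ≤ c)
    (hθ : (Fintype.card Y : ℝ) ^ (1 - β) * lam ^ β < 1)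
    (hu : u =o[atTop] fun n : ℕ => (n : ℝ) ^ β)
    (hrec : ∀ i (n : ℕ) (B : ℝ),
      (∀ r : Y → ℕ, ∑ y, (r y : ℝ) ≤ lam * (n + c) → ∏ y, f (τ i) (r y) ≤ B) →
      f i n ≤ Real.exp (u n) * B) :
    ∃ C, ∀ n i, f i n ≤ Real.exp (C * ((n : ℝ) + 1) ^ β) := by
  obtain ⟨N, hN⟩ := eventually_atTop.1 ((eventually_abs_add_mul_rpow_le hβ0 hlam0 hc
    (Nat.cast_nonneg _) hθ hu).and (eventually_mul_add_lt hlam1 c))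
  obtain ⟨C₀, hC₀⟩ := (Set.finite_range fun p : Fin N × ι => f p.2 p.1).bddAbove
  refine ⟨max 1 C₀, fun n => ?_⟩
  have hC1 : 1 ≤ max 1 C₀ := le_max_left _ _
  set C := max 1 C₀
  induction n using Nat.strong_induction_on with
  | _ n ih =>
  intro i
  rcases lt_or_ge n N with hn | hn
  · calc f i n ≤ C := (hC₀ ⟨(⟨n, hn⟩, i), rfl⟩).trans (le_max_right _ _)
      _ ≤ C * ((n : ℝ) + 1) ^ β := le_mul_of_one_le_right (by linarith)
        (Real.one_le_rpow (by linarith [Nat.cast_nonneg (α := ℝ) n]) hβ0.le)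
      _ ≤ Real.exp (C * ((n : ℝ) + 1) ^ β) := by
        linarith [Real.add_one_le_exp (C * ((n : ℝ) + 1) ^ β)]
  obtain ⟨hgain, hshrink⟩ := hN n hn
  set D := (Fintype.card Y : ℝ) ^ (1 - β) * (lam * (n + c) + Fintype.card Y) ^ β
  calc f i n ≤ Real.exp (u n) * Real.exp (C * D) := hrec i n _ fun r hr =>
        prod_le_exp_of_sum_le hβ0.le hβ1 (by linarith) (hf (τ i)) (fun m hm => ih m hm (τ i))
          hshrink hr
    _ = Real.exp (u n + C * D) := (Real.exp_add _ _).symm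
    _ ≤ Real.exp (C * (|u n| + D)) := by
        rw [Real.exp_le_exp, mul_add]
        gcongr
        exact (le_abs_self _).trans (le_mul_of_one_le_left (abs_nonneg _) hC1)
    _ ≤ Real.exp (C * ((n : ℝ) + 1) ^ β) := by gcongr

end Recursion

/-! ### Growth of groups with a proper length function -/

/-- `B n` behaves like the ball of radius `n` about the identity for a proper length function. It
replaces the length function itself, which would have to be an infimum. -/
structure IsBallSystem {Γ : Type*} [Group Γ] (B : ℕ → Set Γ) : Prop where
  one_mem : 1 ∈ B 0
  mul_mem : ∀ {m n g h}, g ∈ B m → h ∈ B n → g * h ∈ B (m + n)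
  mono : Monotone B
  finite : ∀ n, (B n).Finite
  exists_mem : ∀ g, ∃ n, g ∈ B n

namespace IsBallSystem

variable {Γ : Type*} [Group Γ] {B : ℕ → Set Γ} {S : Set Γ}

theorem list_prod_mem (hB : IsBallSystem B) {L : ℕ} (hSL : S ⊆ B L) :
    ∀ l : List Γ, (∀ s ∈ l, s ∈ S) → l.prod ∈ B (L * l.length)
  | [], _ => hB.one_mem
  | s :: l, hl => by
    rw [List.prod_cons, List.length_cons, mul_add_one, add_comm]
    exact hB.mul_mem (hSL (hl s List.mem_cons_self))
      (hB.list_prod_mem hSL l fun t ht => hl t (List.mem_cons_of_mem s ht))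

theorem growth_le_ncard (hB : IsBallSystem B) {L : ℕ} (hSL : S ⊆ B L) (R : ℝ) :
    growth S R ≤ (B (L * ⌊R⌋₊)).ncard := by
  refine Set.ncard_le_ncard ?_ (hB.finite _)
  rintro _ ⟨l, hl, rfl, hlR⟩
  exact hB.mono (Nat.mul_le_mul_left L (Nat.le_floor hlR)) (hB.list_prod_mem hSL l hl)

theorem exists_subset_of_finite (hB : IsBallSystem B) (hS : S.Finite) : ∃ L, S ⊆ B L := by
  choose ℓ hℓ using hB.exists_mem
  obtain ⟨L, hL⟩ := (hS.image ℓ).bddAbove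
  exact ⟨L, fun s hs => hB.mono (hL (Set.mem_image_of_mem ℓ hs)) (hℓ s)⟩

theorem dominated_growth (hB : IsBallSystem B) (hS : S.Finite) {C α β : ℝ} (hβ : 0 < β)
    (hβα : β ≤ α) (hC : ∀ n, ((B n).ncard : ℝ) ≤ Real.exp (C * ((n : ℝ) + 1) ^ β)) :
    Dominated (fun R => (growth S R : ℝ)) (fun R => Real.exp (R ^ α)) := by
  obtain ⟨L, hSL⟩ := hB.exists_subset_of_finite hS
  have hK1 : 1 ≤ max 1 C ^ β⁻¹ := Real.one_le_rpow (le_max_left 1 C) (inv_nonneg.2 hβ.le)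
  set K := max 1 C ^ β⁻¹
  have hKβ : K ^ β = max 1 C := Real.rpow_inv_rpow (by positivity) hβ.ne'
  have hL1 : (1 : ℝ) ≤ L + 1 := le_add_of_nonneg_left (Nat.cast_nonneg L)
  refine ⟨K * (L + 1), one_le_mul_of_one_le_of_one_le hK1 hL1, fun R hR => ?_⟩
  have hfloor : ((L * ⌊R⌋₊ : ℕ) : ℝ) + 1 ≤ (L + 1) * R := by
    rw [Nat.cast_mul, add_one_mul]
    gcongr
    exact Nat.floor_le (by linarith)
  calc (growth S R : ℝ) ≤ ((B (L * ⌊R⌋₊)).ncard : ℝ) := by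
        exact_mod_cast hB.growth_le_ncard hSL R
    _ ≤ Real.exp (C * (((L * ⌊R⌋₊ : ℕ) : ℝ) + 1) ^ β) := hC _
    _ ≤ Real.exp (K ^ β * ((L + 1) * R) ^ β) := by
        rw [hKβ]
        gcongr
        exact le_max_right 1 C
    _ = Real.exp ((K * (L + 1) * R) ^ β) := by
        rw [← Real.mul_rpow (by positivity) (by positivity), mul_assoc]
    _ ≤ Real.exp ((K * (L + 1) * R) ^ α) := by
        gcongr
        exact one_le_mul_of_one_le_of_one_le (one_le_mul_of_one_le_of_one_le hK1 hL1) hR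

end IsBallSystem

/-! ### Growth of the groups `G i` -/

theorem isBallSystem_preimage_ball (i : ZMod 4) :
    IsBallSystem fun n => ((↑) : G i → Equiv.Perm Pt) ⁻¹' ball i n where
  one_mem := .one 0
  mul_mem := HasWeightLE.mul
  mono := fun _ _ hmn => Set.preimage_mono (ball_mono i hmn)
  finite := fun n => (finite_ball i n).preimage Subtype.val_injective.injOn
  exists_mem := fun g => HasWeightLE.exists_of_mem_G g.2

theorem isLittleO_log_mul_add_pow {β : ℝ} (hβ : 0 < β) :
    (fun n : ℕ => Real.log (6 * ((n : ℝ) + 4) ^ 3)) =o[atTop] fun n : ℕ => (n : ℝ) ^ β := by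
  have hlog : (fun n : ℕ => Real.log (6 * ((n : ℝ) + 4) ^ 3)) =O[atTop]
      fun n : ℕ => Real.log n := by
    refine Asymptotics.IsBigO.of_bound 5 ?_
    filter_upwards [eventually_ge_atTop 8] with n hn
    have hn8 : (8 : ℝ) ≤ n := by exact_mod_cast hn
    have hpoly : 6 * ((n : ℝ) + 4) ^ 3 ≤ n ^ 5 := by
      calc 6 * ((n : ℝ) + 4) ^ 3 ≤ 6 * ((n : ℝ) + n) ^ 3 := by
            gcongr
            linarith
        _ = 48 * (n : ℝ) ^ 3 := by ring
        _ ≤ n ^ 2 * (n : ℝ) ^ 3 := by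
            gcongr
            nlinarith
        _ = n ^ 5 := by ring
    have hone : 1 ≤ 6 * ((n : ℝ) + 4) ^ 3 := by
      nlinarith [one_le_pow₀ (n := 3) (show (1 : ℝ) ≤ n + 4 by linarith)]
    rw [Real.norm_of_nonneg (Real.log_nonneg hone), Real.norm_of_nonneg (Real.log_natCast_nonneg n)]
    simpa only [Real.log_pow, Nat.cast_ofNat] using Real.log_le_log (by linarith) hpoly
  exact hlog.trans_isLittleO
    ((isLittleO_log_rpow_atTop hβ).comp_tendsto tendsto_natCast_atTop_atTop)

theorem exists_ncard_ball_le_exp {β : ℝ} (hβ : contractionExponent 3 (9 / 10) < β) (hβ1 : β ≤ 1) :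
    ∃ C, ∀ n i, ((ball i n).ncard : ℝ) ≤ Real.exp (C * ((n : ℝ) + 1) ^ β) := by
  have hβ0 : 0 < β := (contractionExponent_pos (by norm_num) (by norm_num) (by norm_num)).trans hβ
  refine exists_forall_le_exp_of_contracting (Y := ZMod 3) (τ := (· + 1)) (lam := 9 / 10) (c := 4)
    (fun _ _ => Nat.cast_nonneg _) hβ0 hβ1 (by norm_num) (by norm_num) (by norm_num) ?_
    (isLittleO_log_mul_add_pow hβ0) fun i n B hB => ?_
  · rw [ZMod.card, Nat.cast_ofNat]
    exact rpow_one_sub_mul_rpow_lt_one (by norm_num) (by norm_num) (by norm_num) hβ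
  · rw [Real.exp_log (by positivity)]
    exact ncard_ball_le_of_forall_prod_le hB

theorem dominated_growth {i : ZMod 4} {S : Set (G i)} (hS : S.Finite) {α : ℝ}
    (hα : contractionExponent 3 (9 / 10) < α) :
    Dominated (fun R => (growth S R : ℝ)) (fun R => Real.exp (R ^ α)) := by
  have hβ : contractionExponent 3 (9 / 10) < min α 1 :=
    lt_min hα (contractionExponent_lt_one (by norm_num) (by norm_num) (by norm_num))
  have hβ0 : 0 < min α 1 :=
    (contractionExponent_pos (by norm_num) (by norm_num) (by norm_num)).trans hβ
  obtain ⟨C, hC⟩ := exists_ncard_ball_le_exp hβ (min_le_right α 1)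
  refine (isBallSystem_preimage_ball i).dominated_growth hS hβ0 (min_le_left α 1) fun n =>
    le_trans (Nat.cast_le.2 ?_) (hC n i)
  exact Set.ncard_le_ncard_of_injOn _ (fun _ hg => hg) Subtype.val_injective.injOn (finite_ball i n)

/-! ### The numerical value of the exponent -/

theorem three_fourths_rpow_mem_Ioo : (3 / 4 : ℝ) ^ (1 / 3 : ℝ) ∈ Set.Ioo (9 / 10 : ℝ) 1 := by
  constructor
  · rw [one_div, Real.lt_rpow_inv_iff_of_pos (by norm_num) (by norm_num) (by norm_num)]
    norm_num
  · exact Real.rpow_lt_one (by norm_num) (by norm_num) (by norm_num)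

theorem abs_contractionExponent_sub_lt :
    |contractionExponent 3 ((3 / 4 : ℝ) ^ (1 / 3 : ℝ)) - 0.9197| < 0.00005 := by
  have hlog : Real.log ((3 / 4 : ℝ) ^ (1 / 3 : ℝ)) = (Real.log 3 - 2 * Real.log 2) / 3 := by
    rw [Real.log_rpow (by norm_num), Real.log_div (by norm_num) (by norm_num),
      show (4 : ℝ) = 2 ^ 2 by norm_num, Real.log_pow, Nat.cast_ofNat]
    ring
  -- `84 / 53` and `233 / 147` are approximations of `log 3 / log 2` from below and from above.
  have hlower : 84 * Real.log 2 < 53 * Real.log 3 := by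
    have := Real.log_lt_log (by norm_num) (show (2 : ℝ) ^ 84 < 3 ^ 53 by norm_num)
    simpa only [Real.log_pow, Nat.cast_ofNat] using this
  have hupper : 147 * Real.log 3 < 233 * Real.log 2 := by
    have := Real.log_lt_log (by norm_num) (show (3 : ℝ) ^ 147 < 2 ^ 233 by norm_num)
    simpa only [Real.log_pow, Nat.cast_ofNat] using this
  have hpos : 0 < Real.log 3 - Real.log ((3 / 4 : ℝ) ^ (1 / 3 : ℝ)) :=
    log_sub_log_pos (by norm_num) (by positivity) three_fourths_rpow_mem_Ioo.2
  rw [contractionExponent, abs_sub_lt_iff, sub_lt_iff_lt_add, div_lt_iff₀ hpos, sub_lt_comm,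
    lt_div_iff₀ hpos, hlog]
  constructor <;> linarith

end FabrykowskiGupta

open FabrykowskiGupta in
theorem mainTheorem7_general :
    ((∀ v : Pt, ∀ y : ZMod 3, a (snoc v y) = snoc v (y + 1)) ∧
      (∀ v : Pt, b (snoc v 0) = snoc (a v) 0 ∧ b (snoc v 1) = snoc v 1 ∧
        b (snoc v 2) = snoc (b v) 2) ∧
      (∀ i : ZMod 4, ∀ v : Pt,
        b₁ i (snoc v 0) = snoc ((a ^ (e₁ i).val) v) 0 ∧ b₁ i (snoc v 1) = snoc v 1 ∧
        b₁ i (snoc v 2) = snoc (b₁ (i + 1) v) 2 ∧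
        b₂ i (snoc v 0) = snoc ((a ^ (e₂ i).val) v) 0 ∧ b₂ i (snoc v 1) = snoc v 1 ∧
        b₂ i (snoc v 2) = snoc (b₂ (i + 1) v) 2) ∧
      (∀ i : ZMod 4, ∀ g ∈ G i, ∀ y : ZMod 3, ∃ y' : ZMod 3, ∃ g' ∈ G (i + 1),
        ∀ v : Pt, g (snoc v y) = snoc (g' v) y')) ∧
    (∀ i : ZMod 4,
      Nonempty (H i ≃* Multiplicative (ZMod 3 × ZMod 3)) ∧
      (∀ j : ZMod 4, ActsAs i j (b₁ i) (e₁ j) ∧ ActsAs i j (b₂ i) (e₂ j)) ∧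
      (∀ h ∈ H i, (∀ x : Pt, b x = x → h x = x) ∧ ∀ j : ZMod 4, ∃! c : ZMod 3, ActsAs i j h c) ∧
      (∀ h ∈ H i, h ≠ 1 → ∃! j : ZMod 4, ActsAs i j h 0) ∧
      (∀ h ∈ H i, h xi = xi) ∧
      (∀ g ∈ G i, g xi = xi → ∃! h : Equiv.Perm Pt, h ∈ H i ∧ ∀ᶠ x in 𝓝 xi, g x = h x) ∧
      (∀ g ∈ G i, ∃! h : Equiv.Perm Pt, h ∈ H i ∧ InBranch g h)) ∧
    (∀ i : ZMod 4, ∀ k : ℕ, 1 ≤ k → ∀ h ∈ H i,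
      ∀ w : List (Equiv.Perm Pt), IsTraverseOfType i k w h →
        (∀ j : ZMod 4, ∀ c : ZMod 3, ActsAs i j h c → PassesConnector i k j w c) ∧
        (∀ j : ZMod 4, ∀ c : ZMod 3, c ≠ 0 → PassesConnector i k j w c →
          ∃ j' : ZMod 4, j' ≠ j ∧ PassesConnector i k j' w 0)) ∧
    (∀ i : ZMod 4, ∀ S : Set (G i), S.Finite →
      ∀ α : ℝ, Real.log 3 / (Real.log 3 - Real.log (9 / 10)) < α →
        Dominated (fun R => (growth S R : ℝ)) (fun R => Real.exp (R ^ α))) := by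
  refine ⟨⟨a_snoc, fun v => ⟨b_snoc_zero v, twist_snoc_one _ v, twist_snoc_two _ v⟩,
      fun i v => ⟨b₁_snoc_zero i v, twist_snoc_one _ v, b₁_snoc_two i v,
        b₂_snoc_zero i v, twist_snoc_one _ v, b₂_snoc_two i v⟩,
      fun i g hg y => exists_section hg y⟩,
    fun i => ⟨nonempty_H_mulEquiv i, fun j => ⟨actsAs_b₁ i j, actsAs_b₂ i j⟩,
      fun h hh => ⟨fun x hx => apply_eq_of_b_apply_eq hh hx, existsUnique_actsAs hh⟩,
      fun h hh h1 => existsUnique_actsAs_zero hh h1,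
      fun h hh => apply_xi_of_mem_H hh,
      fun g hg hxi => existsUnique_germ hg hxi,
      fun g hg => existsUnique_inBranch hg⟩,
    fun i k hk h hh w hw => ?_, fun i S hS α hα => dominated_growth hS hα⟩
  obtain ⟨z, rfl⟩ := exists_eq_frag_of_mem_H hh
  exact ⟨fun j c hc => actsAs_frag_iff.1 hc ▸ hw.passesConnector hk j,
    fun j c hc hj => hw.exists_ne_passesConnector_zero hk hc hj⟩

open FabrykowskiGupta in
theorem mainTheorem7 :
    -- the wreath recursions of `a` and `b` and of the fragments, and the self-similar family
    ((∀ v : Pt, ∀ y : ZMod 3, a (snoc v y) = snoc v (y + 1)) ∧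
      (∀ v : Pt, b (snoc v 0) = snoc (a v) 0 ∧ b (snoc v 1) = snoc v 1 ∧
        b (snoc v 2) = snoc (b v) 2) ∧
      (∀ i : ZMod 4, ∀ v : Pt,
        b₁ i (snoc v 0) = snoc ((a ^ (e₁ i).val) v) 0 ∧ b₁ i (snoc v 1) = snoc v 1 ∧
        b₁ i (snoc v 2) = snoc (b₁ (i + 1) v) 2 ∧
        b₂ i (snoc v 0) = snoc ((a ^ (e₂ i).val) v) 0 ∧ b₂ i (snoc v 1) = snoc v 1 ∧
        b₂ i (snoc v 2) = snoc (b₂ (i + 1) v) 2) ∧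
      (∀ i : ZMod 4, ∀ g ∈ G i, ∀ y : ZMod 3, ∃ y' : ZMod 3, ∃ g' ∈ G (i + 1),
        ∀ v : Pt, g (snoc v y) = snoc (g' v) y')) ∧
    -- `H_i` is a fragmentation of `b`, isomorphic to `(ℤ/3)²`, every non-identity element of it
    -- has exactly one vanishing coordinate, and it is the group of germs of `G_i` at `xi`
    (∀ i : ZMod 4,
      Nonempty (H i ≃* Multiplicative (ZMod 3 × ZMod 3)) ∧
      (∀ j : ZMod 4, ActsAs i j (b₁ i) (e₁ j) ∧ ActsAs i j (b₂ i) (e₂ j)) ∧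
      (∀ h ∈ H i, (∀ x : Pt, b x = x → h x = x) ∧ ∀ j : ZMod 4, ∃! c : ZMod 3, ActsAs i j h c) ∧
      (∀ h ∈ H i, h ≠ 1 → ∃! j : ZMod 4, ActsAs i j h 0) ∧
      (∀ h ∈ H i, h xi = xi) ∧
      (∀ g ∈ G i, g xi = xi → ∃! h : Equiv.Perm Pt, h ∈ H i ∧ ∀ᶠ x in 𝓝 xi, g x = h x) ∧
      (∀ g ∈ G i, ∃! h : Equiv.Perm Pt, h ∈ H i ∧ InBranch g h)) ∧
    -- a traverse of nontrivial type passes through the connectors according to its type, and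
    -- if it is of nontrivial type through one of them, it is of type `Id` through another one
    (∀ i : ZMod 4, ∀ k : ℕ, 2 ≤ k → ∀ h ∈ H i, h ≠ 1 →
      ∀ w : List (Equiv.Perm Pt), IsTraverseOfType i k w h →
        (∀ j : ZMod 4, ∀ c : ZMod 3, ActsAs i j h c → PassesConnector i k j w c) ∧
        (∀ j : ZMod 4, ∀ c : ZMod 3, c ≠ 0 → PassesConnector i k j w c →
          ∃ j' : ZMod 4, j' ≠ j ∧ PassesConnector i k j' w 0)) ∧
    -- the growth estimate
    (∀ η : ℝ, η = (3 / 4 : ℝ) ^ (1 / 3 : ℝ) →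
      |Real.log 3 / (Real.log 3 - Real.log η) - 0.9197| < 0.00005 ∧
      ∀ i : ZMod 4, ∀ S : Set (G i), S.Finite → (∀ s ∈ S, s⁻¹ ∈ S) → Subgroup.closure S = ⊤ →
        ∀ α : ℝ, Real.log 3 / (Real.log 3 - Real.log η) < α →
          Dominated (fun R => (growth S R : ℝ)) (fun R => Real.exp (R ^ α))) := by
  obtain ⟨selfSimilar, fragmentation, traverses, growth⟩ := mainTheorem7_general
  refine ⟨selfSimilar, fragmentation, fun i k hk h hh _ => traverses i k (by omega) h hh, ?_⟩
  rintro _ rfl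
  obtain ⟨hη, hη'⟩ := three_fourths_rpow_mem_Ioo
  exact ⟨abs_contractionExponent_sub_lt, fun i S hS _ _ α hα => growth i S hS α <|
    (contractionExponent_lt (by norm_num) (by norm_num) hη hη').trans hα⟩
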